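/- **Setting.** A quintuple $(\nu,\sigma^2,d,\theta_+,\theta_-)$ consists of a Lévy triple ($\nu$ a Lévy measure on $\mathbb R$, $\sigma^2\ge 0$, $d\in\mathbb R$) and two rates $\theta_+,\theta_-\ge 0$. Let $\xi$ be the Lévy process with this triple, i.e. $$\mathbb E e^{iu\xi(t)}=\exp\Big(t\Big[idu-\tfrac12\sigma^2u^2+\int_{\mathbb R}\big(e^{iux}-1-iux\,1_{\{|x|<1\}}\big)\nu(dx)\Big]\Big),\qquad u\in\mathbb R,\ t\ge 0 .$$ The quintuple is *admissible* if $\psi(1):=\log\mathbb E e^{\xi(1)}<\infty$ and $\psi(1)=\theta_--\theta_+$. Let $p_t(x,dy)$ be the transition kernel of $\xi$. Let $L^+$ be the càdlàg process $\xi$ killed at rate $\theta_-$, with kernel $q^+_t(x,dy)=e^{-\theta_-t}p_t(x,dy)$, and let $L^-$ be the (killed, left-continuous with right limits) dual Lévy process, whose kernel $q^-_t$ satisfies $e^{-x}dx\,q^-_t(x,dy)=e^{-y}dy\,q^+_t(y,dx)$. Both start at $0$, and a killed process takes the value $-\infty$. Consider the following independent objects: a Poisson point process (PPP) $\{U_i\}$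 on $\mathbb R$ with intensity $e^{-u}du$; a PPP $\{(\tilde T_i^+,\tilde U_i^+)\}$ on $(0,\infty)\times\mathbb R$ with intensity $\theta_+dt\times e^{-u}du$; a PPP $\{(\tilde T_i^-,\tilde U_i^-)\}$ on $(-\infty,0)\times\mathbb R$ with intensity $\theta_-dt\times e^{-u}du$; independent copies $L_i^+,\tilde L_i^+$ of $L^+$ and $L_i^-,\tilde L_i^-$ of $L^-$. Put $L_i(t)=L_i^+(t)$ for $t\ge 0$ and $L_i(t)=L_i^-(-t)$ for $t<0$, and $$V_i(t)=U_i+L_i(t),$$ $$\tilde V_i^+(t)=\begin{cases}-\infty,&t<\tilde T_i^+,\\ \tilde U_i^++\tilde L_i^+(t-\tilde T_i^+),&t\ge\tilde T_i^+,\end{cases}\qquad \tilde V_i^-(t)=\begin{cases}\tilde U_i^-+\tilde L_i^-(\tilde T_i^--t),&t<\tilde T_i^-,\\ -\infty,&t\ge\tilde T_i^-.\end{cases}$$ A *Lévy–Brown–Resnick process with quintuple* $(\nu,\sigma^2,d,\theta_+,\theta_-)$ (assumed admissible) is a process $\{\eta(t):t\in\mathbb R\}$ with the same law as $\{\sup_i\max(V_i(t),\tilde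 V_i^+(t),\tilde V_i^-(t)):t\in\mathbb R\}$; laws of processes are taken on the path space with the product $\sigma$-algebra. **Proposition.** Let $\{\eta(t):t\in\mathbb R\}$ be a Lévy–Brown–Resnick process with quintuple $(\nu_+,\sigma_+^2,d_+,\theta_+,\theta_-)$. Then there is $d_-\in\mathbb R$ such that the reversed process $\{\eta(-t):t\in\mathbb R\}$ is a Lévy–Brown–Resnick process with quintuple $(\nu_-,\sigma_+^2,d_-,\theta_-,\theta_+)$, where $\nu_-$ is given by $\nu_-(-dx)=e^x\nu_+(dx)$. Moreover, $d_-$ is uniquely determined by the remaining parameters: it is the only real number for which the quintuple $(\nu_-,\sigma_+^2,d_-,\theta_-,\theta_+)$ is admissible. -/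

import Mathlib

open MeasureTheory ProbabilityTheory Filter Topology Set
open scoped NNReal ENNReal

noncomputable section

namespace LBR

/-! ### Lévy triples, marginal laws and transition kernels -/

/-- The parameters `(ν₊, σ₊², d₊, θ₊, θ₋)`. -/
structure Quintuple where
  ν : Measure ℝ
  σ2 : ℝ≥0
  d : ℝ
  θp : ℝ≥0
  θm : ℝ≥0

/-- Lévy measure on `ℝ`: no atom at `0` and `∫ min(1, x²) ν(dx) < ∞`. -/
def IsLevyMeasure (ν : Measure ℝ) : Prop :=
  ν {0} = 0 ∧ ∫⁻ x, ENNReal.ofReal (min 1 (x ^ 2)) ∂ν < ∞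

/-- The characteristic exponent of the Lévy triple `(ν, σ², d)`, with truncation function
`x 1_{|x| < 1}`:  `i d u - σ² u² / 2 + ∫ (e^{iux} - 1 - i u x 1_{|x|<1}) ν(dx)`. -/
def levyExponent (ν : Measure ℝ) (σ2 : ℝ≥0) (d : ℝ) (u : ℝ) : ℂ :=
  Complex.I * d * u - (σ2 : ℝ) * u ^ 2 / 2 +
    ∫ x : ℝ, (Complex.exp (Complex.I * u * x) - 1 -
      (if |x| < 1 then Complex.I * u * x else 0)) ∂ν

/-- `p t` is, for each `t ≥ 0`, the law of `ξ(t)`, where `ξ` is a Lévy process with Lévy triple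
`(ν, σ², d)` (Lévy–Khintchine formula). -/
structure IsLevyMarginals (ν : Measure ℝ) (σ2 : ℝ≥0) (d : ℝ) (p : ℝ≥0 → Measure ℝ) : Prop where
  levyMeasure : IsLevyMeasure ν
  prob : ∀ t, IsProbabilityMeasure (p t)
  charFun_eq : ∀ (t : ℝ≥0) (u : ℝ),
    charFun (p t) u = Complex.exp ((t : ℝ) * levyExponent ν σ2 d u)

/-- `p t` is the law of `ξ(t)` for the Lévy process `ξ` with triple `(ν₊, σ₊², d₊)`, and
`ψ(1) = log E e^{ξ(1)}` is finite and equal to `θ₋ - θ₊`. -/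
structure Quintuple.HasMarginals (Q : Quintuple) (p : ℝ≥0 → Measure ℝ) : Prop where
  marginals : IsLevyMarginals Q.ν Q.σ2 Q.d p
  integrable_exp : Integrable (fun x : ℝ => Real.exp x) (p 1)
  psi_one : Real.log (∫ x, Real.exp x ∂(p 1)) = (Q.θm : ℝ) - (Q.θp : ℝ)

/-- The quintuple is admissible: it consists of a Lévy triple and two rates satisfying
`ψ(1) = log E e^{ξ(1)} < ∞` and `ψ(1) = θ₋ - θ₊`. -/
def Quintuple.IsAdmissible (Q : Quintuple) : Prop :=
  ∃ p : ℝ≥0 → Measure ℝ, Q.HasMarginals p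

/-- The spatially homogeneous kernel `(t, x) ↦` law of `x + Y(t)`, where `κ t` is the (possibly
defective) law of `Y(t)` on `ℝ`. -/
def transition (κ : ℝ≥0 → Measure ℝ) (t : ℝ≥0) (x : ℝ) : Measure ℝ :=
  (κ t).map (fun z => x + z)

/-- Killing at rate `θ`: `q_t = e^{-θ t} p_t`. -/
def killed (θ : ℝ≥0) (p : ℝ≥0 → Measure ℝ) (t : ℝ≥0) : Measure ℝ :=
  ENNReal.ofReal (Real.exp (-((θ : ℝ) * t))) • p t

/-- The measure `e^{-u} du` on `ℝ`. -/
def expMeasure : Measure ℝ :=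
  volume.withDensity (fun u => ENNReal.ofReal (Real.exp (-u)))

/-- Duality with respect to `e^{-u} du`:
`e^{-x} dx q⁻_t(x, dy) = e^{-y} dy q⁺_t(y, dx)` as measures on `ℝ × ℝ`. -/
def IsDual (qm qp : ℝ≥0 → ℝ → Measure ℝ) : Prop :=
  ∀ (t : ℝ≥0) (A B : Set ℝ), MeasurableSet A → MeasurableSet B →
    ∫⁻ x in A, qm t x B ∂expMeasure = ∫⁻ y in B, qp t y A ∂expMeasure

/-! ### Killed Lévy processes; the cemetery state is `⊥ = -∞` -/

/-- `∫_{B₁} q_{s₁}(x, dx₁) ∫_{B₂} q_{s₂}(x₁, dx₂) ⋯` for a list of pairs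
(time increment, set). -/
def pathMass (q : ℝ≥0 → ℝ → Measure ℝ) : ℝ → List (ℝ≥0 × Set ℝ) → ℝ≥0∞
  | _, [] => 1
  | x, (s, B) :: l => ∫⁻ y in B, pathMass q y l ∂(q s x)

/-- The path `f`, from time `t` on, is alive and in `B₁` at time `t + s₁`, alive and in `B₂` at
time `t + s₁ + s₂`, and so on. -/
def Visits (f : ℝ≥0 → EReal) : ℝ≥0 → List (ℝ≥0 × Set ℝ) → Prop
  | _, [] => True
  | t, (s, B) :: l => (∃ x ∈ B, f (t + s) = (x : EReal)) ∧ Visits f (t + s) l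

/-- Right-continuous with left limits, as a function with values in `ℝ ∪ {-∞}`. -/
def IsCadlag (f : ℝ≥0 → EReal) : Prop :=
  ∀ t, f t ≠ ⊤ ∧ ContinuousWithinAt f (Ici t) t ∧ ∃ l, l ≠ ⊤ ∧ Tendsto f (𝓝[<] t) (𝓝 l)

/-- Left-continuous with right limits, as a function with values in `ℝ ∪ {-∞}`. -/
def IsCaglad (f : ℝ≥0 → EReal) : Prop :=
  ∀ t, f t ≠ ⊤ ∧ ContinuousWithinAt f (Iic t) t ∧ ∃ l, l ≠ ⊤ ∧ Tendsto f (𝓝[>] t) (𝓝 l)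

variable {Ω : Type*} [MeasurableSpace Ω]

/-- `Y` starts at `0` and moves, while it is alive, according to the spatially homogeneous
sub-Markov kernels `transition κ`; that is, `Y` has the finite-dimensional distributions of the
(possibly killed) Lévy process with these kernels. -/
structure IsKilledLevy (Y : ℝ≥0 → Ω → EReal) (κ : ℝ≥0 → Measure ℝ) (P : Measure Ω) : Prop where
  measurable : ∀ t, Measurable (Y t)
  fdd : ∀ l : List (ℝ≥0 × Set ℝ), (∀ a ∈ l, MeasurableSet a.2) →
    P {ω | Visits (fun t => Y t ω) 0 l} = pathMass (transition κ) 0 l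

/-! ### Poisson point processes -/

/-- A random, finite or infinite, sequence of points `(pt i)` with `i < card`. -/
structure RandomPoints (Ω : Type*) [MeasurableSpace Ω] (E : Type*) [MeasurableSpace E] where
  card : Ω → ℕ∞
  pt : ℕ → Ω → E
  measurable_card : Measurable card
  measurable_pt : ∀ i, Measurable (pt i)

/-- The random counting measure `∑_{i < card} δ_{pt i}`. -/
def RandomPoints.count {E : Type*} [MeasurableSpace E] (X : RandomPoints Ω E) (ω : Ω) :
    Measure E :=
  Measure.sum (fun i : {i : ℕ // (i : ℕ∞) < X.card ω} => Measure.dirac (X.pt i ω))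

/-- The σ-algebra generated by a random sequence of points. -/
@[reducible] def RandomPoints.sigma {E : Type*} [MeasurableSpace E] (X : RandomPoints Ω E) :
    MeasurableSpace Ω :=
  MeasurableSpace.comap (fun ω => (X.card ω, fun i => X.pt i ω)) inferInstance

/-- The points form a Poisson point process (PPP) with intensity `μ`. -/
structure RandomPoints.IsPPP {E : Type*} [MeasurableSpace E] (X : RandomPoints Ω E)
    (μ : Measure E) (P : Measure Ω) : Prop where
  law : ∀ B, MeasurableSet B → μ B ≠ ∞ →
    P.map (fun ω => X.count ω B) =
      (poissonMeasure (μ B).toNNReal).map (fun n : ℕ => (n : ℝ≥0∞))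
  indep : ∀ (n : ℕ) (B : Fin n → Set E), (∀ j, MeasurableSet (B j)) →
    Pairwise (fun j k => Disjoint (B j) (B k)) →
    iIndepFun (fun j ω => X.count ω (B j)) P

/-! ### The particle system -/

/-- Positions and motions of all particles. -/
structure ParticleSystem (Ω : Type*) [MeasurableSpace Ω] where
  /-- Positions `Uᵢ` at time `0` of the particles present at time `0`. -/
  init : RandomPoints Ω ℝ
  /-- Birth times and initial positions of the particles born after time `0`. -/
  born : RandomPoints Ω (ℝ × ℝ)
  /-- Killing times and terminal positions of the particles killed before time `0`. -/
  dead : RandomPoints Ω (ℝ × ℝ)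
  /-- Forward motions of the particles present at time `0`. -/
  Lp : ℕ → ℝ≥0 → Ω → EReal
  /-- Backward motions of the particles present at time `0`. -/
  Lm : ℕ → ℝ≥0 → Ω → EReal
  /-- Forward motions of the particles born after time `0`. -/
  bornL : ℕ → ℝ≥0 → Ω → EReal
  /-- Backward motions of the particles killed before time `0`. -/
  deadL : ℕ → ℝ≥0 → Ω → EReal

/-- Labels of the independent ingredients of a particle system. -/
inductive Source where
  | init : Source
  | born : Source
  | dead : Source
  | Lp : ℕ → Source
  | Lm : ℕ → Source
  | bornL : ℕ → Source
  | deadL : ℕ → Source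

namespace ParticleSystem

/-- The σ-algebra generated by a stochastic process on `[0, ∞)`. -/
@[reducible] def pathSigma (Y : ℝ≥0 → Ω → EReal) : MeasurableSpace Ω :=
  MeasurableSpace.comap (fun ω t => Y t ω) inferInstance

/-- The σ-algebra generated by each of the ingredients. -/
@[reducible] def sigma (S : ParticleSystem Ω) : Source → MeasurableSpace Ω
  | .init => S.init.sigma
  | .born => S.born.sigma
  | .dead => S.dead.sigma
  | .Lp i => pathSigma (S.Lp i)
  | .Lm i => pathSigma (S.Lm i)
  | .bornL i => pathSigma (S.bornL i)
  | .deadL i => pathSigma (S.deadL i)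

/-- Two-sided motion: `L(t) = L⁺(t)` for `t ≥ 0` and `L(t) = L⁻(-t)` for `t < 0`. -/
def twoSided (S : ParticleSystem Ω) (i : ℕ) (t : ℝ) (ω : Ω) : EReal :=
  if 0 ≤ t then S.Lp i t.toNNReal ω else S.Lm i (-t).toNNReal ω

/-- Trajectory of a particle present at time `0`. -/
def V (S : ParticleSystem Ω) (i : ℕ) (t : ℝ) (ω : Ω) : EReal :=
  (S.init.pt i ω : EReal) + S.twoSided i t ω

/-- Trajectory of a particle born after time `0`. -/
def bornV (S : ParticleSystem Ω) (i : ℕ) (t : ℝ) (ω : Ω) : EReal :=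
  if t < (S.born.pt i ω).1 then ⊥
  else ((S.born.pt i ω).2 : EReal) + S.bornL i (t - (S.born.pt i ω).1).toNNReal ω

/-- Trajectory of a particle killed before time `0`. -/
def deadV (S : ParticleSystem Ω) (i : ℕ) (t : ℝ) (ω : Ω) : EReal :=
  if t < (S.dead.pt i ω).1 then
    ((S.dead.pt i ω).2 : EReal) + S.deadL i ((S.dead.pt i ω).1 - t).toNNReal ω
  else ⊥

/-- The pointwise supremum of all trajectories. -/
def eta (S : ParticleSystem Ω) (t : ℝ) (ω : Ω) : EReal :=
  (⨆ (i : ℕ) (_ : (i : ℕ∞) < S.init.card ω), S.V i t ω) ⊔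
  (⨆ (i : ℕ) (_ : (i : ℕ∞) < S.born.card ω), S.bornV i t ω) ⊔
  (⨆ (i : ℕ) (_ : (i : ℕ∞) < S.dead.card ω), S.deadV i t ω)

/-- The particle system has the parameters `Q`. Here `p t` is the law of `ξ(t)`, the kernel of
`L⁺` is `q⁺_t(x, dy) = e^{-θ₋ t} p_t(x, dy)`, and the (spatially homogeneous) kernel
`q⁻ = transition κm` of `L⁻` is its dual with respect to `e^{-u} du`. -/
structure HasParameters (S : ParticleSystem Ω) (Q : Quintuple) (P : Measure Ω)
    (p κm : ℝ≥0 → Measure ℝ) : Prop where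
  marginals : Q.HasMarginals p
  dual : IsDual (transition κm) (transition (killed Q.θm p))
  init_ppp : S.init.IsPPP expMeasure P
  born_ppp : S.born.IsPPP ((Q.θp • volume.restrict (Ioi (0 : ℝ))).prod expMeasure) P
  dead_ppp : S.dead.IsPPP ((Q.θm • volume.restrict (Iio (0 : ℝ))).prod expMeasure) P
  Lp_law : ∀ i, IsKilledLevy (S.Lp i) (killed Q.θm p) P
  Lm_law : ∀ i, IsKilledLevy (S.Lm i) κm P
  bornL_law : ∀ i, IsKilledLevy (S.bornL i) (killed Q.θm p) P
  deadL_law : ∀ i, IsKilledLevy (S.deadL i) κm P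
  Lp_cadlag : ∀ i ω, IsCadlag (fun t => S.Lp i t ω)
  Lm_caglad : ∀ i ω, IsCaglad (fun t => S.Lm i t ω)
  bornL_cadlag : ∀ i ω, IsCadlag (fun t => S.bornL i t ω)
  deadL_caglad : ∀ i ω, IsCaglad (fun t => S.deadL i t ω)
  indep : iIndep S.sigma P

end ParticleSystem

/-- `η` is a Lévy–Brown–Resnick process with quintuple `Q`: it has the same law (on the path
space, with the product σ-algebra) as the supremum process of some particle system with
parameters `Q`. -/
def IsLevyBrownResnick.{u} {Ω : Type u} [MeasurableSpace Ω] (η : ℝ → Ω → EReal) (P : Measure Ω)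
    (Q : Quintuple) : Prop :=
  ∃ (Ω' : Type u) (_ : MeasurableSpace Ω') (P' : Measure Ω') (_ : IsProbabilityMeasure P')
    (S : ParticleSystem Ω') (p κm : ℝ≥0 → Measure ℝ),
    S.HasParameters Q P' p κm ∧
    IdentDistrib (fun ω t => η t ω) (fun ω t => S.eta t ω) P P'

/-- The measure `ν₋` with `ν₋(-dx) = e^x ν₊(dx)`. -/
def reversedLevyMeasure (ν : Measure ℝ) : Measure ℝ :=
  (ν.withDensity (fun x => ENNReal.ofReal (Real.exp x))).map (fun x => -x)

end LBR

end

/-! Read backwards in time, the particle system is again one of the same type: forward and backward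
motions change roles, and births become deaths with reflected times. What must be shown is that the
backward motion `κm` is itself a Lévy process killed at rate `θp`.

Duality with respect to `e^{-u} du` forces `κm t` to be the reflection of `e^x e^{-θm t} p t (dx)`
(`IsDual.eq_reversedLevyMeasure`). Since `κm t` is the law of a living particle, its mass is at most
one, so `∫ e^x ∂(p t) ≤ e^{θm t}` for every `t`, although admissibility speaks of `t = 1` only.
These bounds pass to the Lévy measure, which therefore integrates `min 1 (x ^ 2) * (1 + e^x)`
(`IsLevyMarginals.integrable_min_mul_one_add_exp`). The Laplace exponent is then holomorphic in the
strip `0 < Re z < 1` and continuous up to its boundary, and the Lévy–Khintchine formula extends from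
the imaginary axis to the closed strip (`IsLevyMarginals.integral_exp_eq`). On the line `Re z = 1`
it says that the Esscher transform of the process, reflected, is Lévy with exponent `Ψ(1 - iu) -
Ψ(1)`, whose triple is computed in `levyExponent_reversedLevyMeasure`. Because `Ψ(1) = θm - θp`,
normalising by `e^{-tΨ(1)}` turns killing at rate `θm` into killing at rate `θp`.

Reversal also exchanges càdlàg with càglàd paths, so the motions are replaced by their left or right
limits. Killed Lévy processes have no fixed discontinuities, hence this changes nothing almost
surely at a given time; for particles born or killed at random times the same follows by Fubini,
their motion being independent of those times. The two suprema thus agree almost surely at each time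
(`ParticleSystem.HasParameters.reverse_eta_ae_eq`), which suffices for equality in law on the
product σ-algebra. The drift is unique because changing it by `c` changes `ψ(1)` by `c`. -/

noncomputable section

namespace LBR

open Complex.HadamardThreeLines

/-! ### The Lévy–Khintchine integrand -/

/-- The integrand `e^{zx} - 1 - zx 1_{|x|<1}`. -/
def expRem (z : ℂ) (x : ℝ) : ℂ :=
  Complex.exp (z * x) - 1 - (if |x| < 1 then z * x else 0)

/-- The Laplace exponent `d z + σ² z² / 2 + ∫ (e^{zx} - 1 - zx 1_{|x|<1}) ν(dx)`. -/
def laplaceExponent (ν : Measure ℝ) (σ2 : ℝ≥0) (d : ℝ) (z : ℂ) : ℂ :=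
  d * z + (σ2 : ℝ) * z ^ 2 / 2 + ∫ x : ℝ, expRem z x ∂ν

lemma levyExponent_eq_laplaceExponent (ν : Measure ℝ) (σ2 : ℝ≥0) (d u : ℝ) :
    levyExponent ν σ2 d u = laplaceExponent ν σ2 d (Complex.I * u) := by
  unfold levyExponent laplaceExponent expRem
  congr 1
  rw [mul_pow, Complex.I_sq]
  ring

lemma measurable_expRem : Measurable (fun q : ℂ × ℝ => expRem q.1 q.2) := by
  unfold expRem
  refine Measurable.sub (by fun_prop) (Measurable.ite ?_ (by fun_prop) measurable_const)
  exact measurableSet_lt (by fun_prop) measurable_const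

lemma measurable_expRem_right (z : ℂ) : Measurable (expRem z) :=
  measurable_expRem.comp measurable_prodMk_left

/-- On the convex left half-plane the derivative of `exp` has norm at most one. The constant 1
matters: it later yields bounds uniform in `n` for `n (e^{z/n} - 1)` and linear in `t` for `e^{tz} -
1`. -/
lemma norm_exp_sub_one_le_of_re_nonpos {z : ℂ} (hz : z.re ≤ 0) : ‖Complex.exp z - 1‖ ≤ ‖z‖ := by
  have hc : Convex ℝ {w : ℂ | w.re ≤ 0} := convex_halfSpace_re_le 0
  have := hc.norm_image_sub_le_of_norm_hasDerivWithin_le (f := Complex.exp) (f' := Complex.exp)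
    (C := 1) (x := 0) (y := z) (fun x _ => (Complex.hasDerivAt_exp x).hasDerivWithinAt)
    (fun x hx => by rw [Complex.norm_exp]; exact Real.exp_le_one_iff.2 hx) (by simp) hz
  simpa using this

lemma norm_exp_I_sub_one_sub_le (y : ℝ) :
    ‖Complex.exp (Complex.I * y) - 1 - Complex.I * y‖ ≤ 3 * y ^ 2 := by
  have hn : ‖Complex.I * (y : ℂ)‖ = |y| := by simp
  rcases le_total |y| 1 with h | h
  · have := Complex.norm_exp_sub_one_sub_id_le (x := Complex.I * y) (by rw [hn]; exact h)
    rw [hn, sq_abs] at this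
    nlinarith [sq_nonneg y]
  · have h1 : ‖Complex.exp (Complex.I * y) - 1‖ ≤ |y| := by
      rw [← hn]; exact norm_exp_sub_one_le_of_re_nonpos (by simp)
    have h2 := norm_sub_le (Complex.exp (Complex.I * y) - 1) (Complex.I * y)
    rw [hn] at h2
    have : |y| ≤ y ^ 2 := by rw [← sq_abs]; nlinarith
    linarith

/-- Growth that is only quadratic in `u` makes the Lévy exponent integrable against a Gaussian law,
while `min 1 (x ^ 2)` is what a Lévy measure integrates. -/
lemma norm_expRem_I_le (u x : ℝ) :
    ‖expRem (Complex.I * u) x‖ ≤ 3 * (1 + u ^ 2) * min 1 (x ^ 2) := by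
  unfold expRem
  split_ifs with h
  · have hx : x ^ 2 ≤ 1 := by rw [← sq_abs]; nlinarith [abs_nonneg x]
    rw [min_eq_right hx]
    have := norm_exp_I_sub_one_sub_le (u * x)
    push_cast at this
    rw [← mul_assoc] at this
    nlinarith [sq_nonneg x, sq_nonneg (u * x)]
  · have hx : 1 ≤ x ^ 2 := by rw [← sq_abs]; nlinarith [not_lt.1 h]
    rw [min_eq_left hx, sub_zero]
    have h1 := norm_sub_le (Complex.exp (Complex.I * u * x)) 1
    have h2 : ‖Complex.exp (Complex.I * u * x)‖ = 1 := by
      rw [Complex.norm_exp]; simp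
    rw [h2, norm_one] at h1
    nlinarith [sq_nonneg u]

lemma exp_mul_le_one_add_exp {a : ℝ} (h0 : 0 ≤ a) (h1 : a ≤ 1) (x : ℝ) :
    Real.exp (a * x) ≤ 1 + Real.exp x := by
  rcases le_total x 0 with h | h
  · have : Real.exp (a * x) ≤ 1 := Real.exp_le_one_iff.2 (mul_nonpos_of_nonneg_of_nonpos h0 h)
    linarith [Real.exp_pos x]
  · have : Real.exp (a * x) ≤ Real.exp x := Real.exp_le_exp.2 (by nlinarith)
    linarith

lemma norm_exp_sub_one_sub_le (y : ℂ) :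
    ‖Complex.exp y - 1 - y‖ ≤ ‖y‖ ^ 2 * Real.exp ‖y‖ := by
  have := Complex.norm_exp_sub_sum_le_norm_mul_exp y 2
  simpa [Finset.sum_range_succ, sub_sub] using this

/-- Taylor's formula handles `|x| < 1`, and `e^{ax} ≤ 1 + e^x` for `0 ≤ a ≤ 1` handles the tails.
The factor in `z` is locally bounded, so one integrable weight dominates `expRem w` for all `w` near
a given point of the strip. -/
lemma norm_expRem_le {z : ℂ} (h0 : 0 ≤ z.re) (h1 : z.re ≤ 1) (x : ℝ) :
    ‖expRem z x‖ ≤ (2 + ‖z‖ ^ 2 * Real.exp ‖z‖) * (min 1 (x ^ 2) * (1 + Real.exp x)) := by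
  have hE : 0 < Real.exp x := Real.exp_pos x
  have hZ : 0 ≤ ‖z‖ ^ 2 * Real.exp ‖z‖ := by positivity
  unfold expRem
  split_ifs with h
  · have hx : x ^ 2 ≤ 1 := by rw [← sq_abs]; nlinarith [abs_nonneg x]
    rw [min_eq_right hx]
    have h3 := norm_exp_sub_one_sub_le (z * x)
    rw [norm_mul, Complex.norm_real, Real.norm_eq_abs, mul_pow, sq_abs] at h3
    have h4 : Real.exp (‖z‖ * |x|) ≤ Real.exp ‖z‖ :=
      Real.exp_le_exp.2 (mul_le_of_le_one_right (norm_nonneg _) h.le)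
    calc _ ≤ ‖z‖ ^ 2 * x ^ 2 * Real.exp (‖z‖ * |x|) := h3
      _ ≤ ‖z‖ ^ 2 * x ^ 2 * Real.exp ‖z‖ := by gcongr
      _ = (‖z‖ ^ 2 * Real.exp ‖z‖) * (x ^ 2 * 1) := by ring
      _ ≤ _ := by gcongr <;> linarith
  · have hx : 1 ≤ x ^ 2 := by rw [← sq_abs]; nlinarith [not_lt.1 h]
    rw [min_eq_left hx, sub_zero, one_mul]
    have h3 := norm_sub_le (Complex.exp (z * x)) 1
    have h2 : ‖Complex.exp (z * x)‖ = Real.exp (z.re * x) := by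
      rw [Complex.norm_exp]; simp
    rw [h2, norm_one] at h3
    have := exp_mul_le_one_add_exp h0 h1 x
    nlinarith

lemma IsLevyMeasure.integrable_min {ν : Measure ℝ} (hν : IsLevyMeasure ν) :
    Integrable (fun x : ℝ => min 1 (x ^ 2)) ν := by
  refine ⟨by fun_prop, ?_⟩
  rw [hasFiniteIntegral_iff_ofReal (ae_of_all _ fun x => by positivity)]
  exact hν.2

/-- By Markov's inequality the sets where `f` is at least `1 / (n + 1)` have finite measure, and
they exhaust the complement of the zero set of `f`. For a Lévy measure that zero set is `{0}`;
σ-finiteness is needed for Fubini. -/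
lemma sigmaFinite_of_lintegral_lt_top {α : Type*} [MeasurableSpace α] {μ : Measure α}
    {f : α → ℝ≥0∞} (hf : Measurable f) (h : ∫⁻ x, f x ∂μ < ∞) (h0 : μ {x | f x = 0} < ∞) :
    SigmaFinite μ := by
  refine ⟨⟨⟨fun n => {x | f x = 0} ∪ {x | ((n : ℝ≥0∞) + 1)⁻¹ ≤ f x}, fun _ => trivial, ?_, ?_⟩⟩⟩
  · intro n
    refine (measure_union_lt_top h0 ?_)
    refine (meas_ge_le_lintegral_div hf.aemeasurable (by simp) (by simp)).trans_lt ?_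
    exact ENNReal.div_lt_top h.ne (by simp)
  · refine eq_univ_of_forall fun x => mem_iUnion.2 ?_
    by_cases hx : f x = 0
    · exact ⟨0, Or.inl hx⟩
    · obtain ⟨n, hn⟩ := ENNReal.exists_inv_nat_lt hx
      exact ⟨n, Or.inr (le_trans (ENNReal.inv_le_inv.2 (by simp)) hn.le)⟩

lemma IsLevyMeasure.sigmaFinite {ν : Measure ℝ} (hν : IsLevyMeasure ν) : SigmaFinite ν := by
  refine sigmaFinite_of_lintegral_lt_top (by fun_prop) hν.2 ?_
  have : {x : ℝ | ENNReal.ofReal (min 1 (x ^ 2)) = 0} ⊆ {0} := by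
    intro x hx
    simpa using hx
  exact (measure_mono this).trans_lt (by simp [hν.1])

lemma IsLevyMeasure.integrable_expRem_I {ν : Measure ℝ} (hν : IsLevyMeasure ν) (u : ℝ) :
    Integrable (expRem (Complex.I * u)) ν :=
  (hν.integrable_min.const_mul (3 * (1 + u ^ 2))).mono'
    (measurable_expRem_right _).aestronglyMeasurable (ae_of_all _ fun x => norm_expRem_I_le u x)

lemma IsLevyMeasure.norm_levyExponent_le {ν : Measure ℝ} (hν : IsLevyMeasure ν) (σ2 : ℝ≥0)
    (d u : ℝ) :
    ‖levyExponent ν σ2 d u‖ ≤ (|d| + σ2 + 3 * ∫ x, min 1 (x ^ 2) ∂ν) * (1 + u ^ 2) := by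
  rw [levyExponent_eq_laplaceExponent]
  unfold laplaceExponent
  have h1 : ‖∫ x : ℝ, expRem (Complex.I * u) x ∂ν‖ ≤ 3 * (1 + u ^ 2) * ∫ x, min 1 (x ^ 2) ∂ν := by
    rw [← integral_const_mul]
    exact norm_integral_le_of_norm_le (hν.integrable_min.const_mul _)
      (ae_of_all _ fun x => norm_expRem_I_le u x)
  have h2 : ‖(d : ℂ) * (Complex.I * u)‖ ≤ |d| * (1 + u ^ 2) := by
    simp only [norm_mul, Complex.norm_I, Complex.norm_real, Real.norm_eq_abs, one_mul]
    gcongr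
    rw [← sq_abs]
    nlinarith [sq_nonneg (|u| - 1), sq_nonneg (|u|)]
  have h3 : ‖((σ2 : ℝ) : ℂ) * (Complex.I * u) ^ 2 / 2‖ ≤ σ2 * (1 + u ^ 2) := by
    simp only [norm_mul, norm_div, norm_pow, Complex.norm_I, Complex.norm_real, Real.norm_eq_abs,
      one_mul, sq_abs, NNReal.abs_eq, Complex.norm_ofNat]
    nlinarith [mul_nonneg σ2.coe_nonneg (sq_nonneg u), σ2.coe_nonneg]
  refine (norm_add₃_le).trans ?_
  linarith

lemma IsLevyMeasure.measurable_levyExponent {ν : Measure ℝ} (hν : IsLevyMeasure ν) (σ2 : ℝ≥0)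
    (d : ℝ) : Measurable (levyExponent ν σ2 d) := by
  have := hν.sigmaFinite
  have h : Measurable fun u : ℝ => ∫ x : ℝ, expRem (Complex.I * u) x ∂ν := by
    refine StronglyMeasurable.measurable ?_
    refine StronglyMeasurable.integral_prod_right' (f := fun q : ℝ × ℝ => expRem (Complex.I * q.1) q.2) ?_
    exact (measurable_expRem.comp (by fun_prop : Measurable fun q : ℝ × ℝ =>
      ((Complex.I * q.1 : ℂ), q.2))).stronglyMeasurable
  have h' : levyExponent ν σ2 d = fun u : ℝ => (d : ℂ) * (Complex.I * u) +
      (σ2 : ℝ) * (Complex.I * u) ^ 2 / 2 + ∫ x : ℝ, expRem (Complex.I * u) x ∂ν :=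
    funext fun u => levyExponent_eq_laplaceExponent ν σ2 d u
  rw [h']
  fun_prop

lemma IsLevyMarginals.re_levyExponent_nonpos {ν : Measure ℝ} {σ2 : ℝ≥0} {d : ℝ}
    {p : ℝ≥0 → Measure ℝ} (h : IsLevyMarginals ν σ2 d p) (u : ℝ) :
    (levyExponent ν σ2 d u).re ≤ 0 := by
  have := h.prob 1
  have h1 := norm_charFun_le_one (μ := p 1) (t := u)
  rw [h.charFun_eq, Complex.norm_exp] at h1
  simpa using h1

lemma tendsto_nat_mul_exp_div_sub_one (z : ℂ) :
    Tendsto (fun n : ℕ => (n : ℂ) * (Complex.exp (z / n) - 1)) atTop (𝓝 z) := by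
  have h := ((Complex.hasDerivAt_exp (z * 0)).comp (0 : ℂ) ((hasDerivAt_id (0 : ℂ)).const_mul z))
  rw [hasDerivAt_iff_tendsto_slope_zero] at h
  have h2 : Tendsto (fun n : ℕ => ((n : ℂ))⁻¹) atTop (𝓝[≠] 0) := by
    rw [tendsto_nhdsWithin_iff]
    refine ⟨tendsto_inv_atTop_nhds_zero_nat, ?_⟩
    filter_upwards [eventually_gt_atTop 0] with n hn
    simpa using hn.ne'
  have h3 := h.comp h2
  simpa [Function.comp_def, div_eq_mul_inv] using h3

lemma norm_nat_mul_exp_div_sub_one_le {z : ℂ} (hz : z.re ≤ 0) (n : ℕ) :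
    ‖(n : ℂ) * (Complex.exp (z / n) - 1)‖ ≤ ‖z‖ := by
  rcases Nat.eq_zero_or_pos n with rfl | hn
  · simp
  have h1 := norm_exp_sub_one_le_of_re_nonpos (z := z / n)
    (by rw [Complex.div_natCast_re]; exact div_nonpos_of_nonpos_of_nonneg hz (by positivity))
  rw [norm_div, Complex.norm_natCast] at h1
  rw [norm_mul, Complex.norm_natCast]
  have : (0 : ℝ) < n := by exact_mod_cast hn
  calc _ ≤ (n : ℝ) * (‖z‖ / n) := by gcongr
    _ = _ := by field_simp

/-! ### The exponential moment of the Lévy measure -/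

/-- The weight `1 - e^{-x²/2}`. -/
def gaussWeight (x : ℝ) : ℝ := 1 - Real.exp (-x ^ 2 / 2)

lemma continuous_gaussWeight : Continuous gaussWeight := by
  unfold gaussWeight; fun_prop

lemma gaussWeight_nonneg (x : ℝ) : 0 ≤ gaussWeight x := by
  have : Real.exp (-x ^ 2 / 2) ≤ 1 := Real.exp_le_one_iff.2 (by nlinarith [sq_nonneg x])
  unfold gaussWeight; linarith

lemma gaussWeight_le_min (x : ℝ) : gaussWeight x ≤ min 1 (x ^ 2) := by
  have h1 := Real.exp_pos (-x ^ 2 / 2)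
  have h2 := Real.add_one_le_exp (-x ^ 2 / 2)
  unfold gaussWeight
  refine le_min (by linarith) (by nlinarith [sq_nonneg x])

lemma gaussWeight_le_one (x : ℝ) : gaussWeight x ≤ 1 :=
  (gaussWeight_le_min x).trans (min_le_left _ _)

lemma min_le_gaussWeight (x : ℝ) : min 1 (x ^ 2) ≤ 3 * gaussWeight x := by
  have h2 := Real.add_one_le_exp (x ^ 2 / 2)
  have hx := sq_nonneg x
  have h3 : Real.exp (-x ^ 2 / 2) * (x ^ 2 / 2 + 1) ≤ 1 := by
    calc _ ≤ Real.exp (-x ^ 2 / 2) * Real.exp (x ^ 2 / 2) := by gcongr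
      _ = 1 := by rw [← Real.exp_add]; simp [neg_div]
  have h4 := Real.exp_pos (-x ^ 2 / 2)
  unfold gaussWeight
  rcases le_total (x ^ 2) 1 with h | h
  · rw [min_eq_right h]
    nlinarith
  · rw [min_eq_left h]
    nlinarith

/-- The sine replaces the truncated linear compensator: it is the imaginary part of `e^{ix}`, so its
small-time mean is read off the characteristic function. -/
lemma exp_mul_gaussWeight_le (x : ℝ) :
    Real.exp x * gaussWeight x ≤ 5 * (Real.exp x - 1 - Real.sin x + 7 * gaussWeight x) := by
  have hw := gaussWeight_nonneg x
  have hw1 := gaussWeight_le_one x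
  have hm := min_le_gaussWeight x
  have hs := Real.sin_le_one x
  rcases le_or_gt x 1 with h | h
  · have hE : Real.exp x ≤ 3 := (Real.exp_le_exp.2 h).trans (by linarith [Real.exp_one_lt_d9])
    -- The worst case is `x < -1`, where the right side may approach `-2` while `1 ≤ 3 * gaussWeight
    -- x`. With 7 in place of 6 one `gaussWeight x` is left over, and five of these exceed `e^x *
    -- gaussWeight x`, since `e^x ≤ 3` here.
    have key : -(6 * gaussWeight x) ≤ Real.exp x - 1 - Real.sin x := by
      rcases le_or_gt (-1) x with h' | h'
      · have hx : x ^ 2 ≤ 1 := by nlinarith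
        rw [min_eq_right hx] at hm
        have h1 := Real.add_one_le_exp x
        rcases le_or_gt 0 x with h0 | h0
        · linarith [Real.sin_le h0]
        · have := Real.sin_gt_sub_cube (x := -x) (by linarith)
          rw [Real.sin_neg] at this
          nlinarith [sq_nonneg x]
      · have hx : 1 ≤ x ^ 2 := by nlinarith
        rw [min_eq_left hx] at hm
        linarith [Real.exp_pos x]
    nlinarith
  · have hE : 2.7 ≤ Real.exp x := by
      have := Real.exp_le_exp.2 h.le
      linarith [Real.exp_one_gt_d9]
    nlinarith

/-! ### Gaussian averages of characteristic functions and exponents -/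

lemma integral_exp_gaussianReal (x : ℝ) :
    ∫ v, Complex.exp (x * v * Complex.I) ∂(gaussianReal 0 1) = Complex.exp (-(x : ℂ) ^ 2 / 2) := by
  rw [← charFun_apply_real, charFun_gaussianReal]
  simp [neg_div]

lemma norm_exp_ofReal_mul_ofReal_mul_I (x y : ℝ) :
    ‖Complex.exp (x * y * Complex.I)‖ = 1 := by
  exact_mod_cast Complex.norm_exp_ofReal_mul_I (x * y)

/-- Since `e^{-x²/2}` is the mean of `e^{ixv}` for a standard Gaussian `v`, Fubini expresses the
Fourier transform of the weighted measure through increments of the characteristic function. -/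
lemma integral_exp_mul_gaussWeight (p : Measure ℝ) [IsFiniteMeasure p] (u : ℝ) :
    ∫ x, Complex.exp (u * x * Complex.I) * gaussWeight x ∂p =
      ∫ v, (charFun p u - charFun p (u + v)) ∂(gaussianReal 0 1) := by
  have hi : Integrable (fun q : ℝ × ℝ => Complex.exp ((u + q.1 : ℝ) * q.2 * Complex.I))
      ((gaussianReal 0 1).prod p) := by
    refine (integrable_const (1 : ℝ)).mono' (by fun_prop) (ae_of_all _ fun q => ?_)
    rw [norm_exp_ofReal_mul_ofReal_mul_I]
  have hi2 : Integrable (fun x : ℝ => Complex.exp (u * x * Complex.I)) p := by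
    refine (integrable_const (1 : ℝ)).mono' (by fun_prop) (ae_of_all _ fun q => ?_)
    rw [norm_exp_ofReal_mul_ofReal_mul_I]
  have hi3 : Integrable (fun x : ℝ => Complex.exp (u * x * Complex.I) *
      Complex.exp (-(x : ℂ) ^ 2 / 2)) p := by
    refine (integrable_const (1 : ℝ)).mono' (by fun_prop) (ae_of_all _ fun q => ?_)
    rw [norm_mul, norm_exp_ofReal_mul_ofReal_mul_I, Complex.norm_exp, one_mul,
      Real.exp_le_one_iff]
    have : (-(q : ℂ) ^ 2 / 2).re = -q ^ 2 / 2 := by norm_cast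
    rw [this]
    nlinarith [sq_nonneg q]
  have hc : Integrable (fun v : ℝ => charFun p (u + v)) (gaussianReal 0 1) := by
    have := hi.integral_prod_left
    simpa [charFun_apply_real] using this
  rw [integral_sub (integrable_const _) hc]
  have h1 : ∫ v, charFun p (u + v) ∂(gaussianReal 0 1) =
      ∫ x, Complex.exp (u * x * Complex.I) * Complex.exp (-(x : ℂ) ^ 2 / 2) ∂p := by
    simp_rw [charFun_apply_real]
    rw [integral_integral_swap hi]
    refine integral_congr_ae (ae_of_all _ fun x => ?_)
    simp only
    rw [← integral_exp_gaussianReal, ← integral_const_mul]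
    refine integral_congr_ae (ae_of_all _ fun v => ?_)
    simp only
    rw [← Complex.exp_add]
    push_cast
    ring_nf
  rw [h1]
  simp only [integral_const, probReal_univ, one_smul, charFun_apply_real]
  rw [← integral_sub hi2 hi3]
  refine integral_congr_ae (ae_of_all _ fun x => ?_)
  simp only [gaussWeight]
  push_cast
  ring

lemma integrable_one_add_sq_gaussianReal (u : ℝ) :
    Integrable (fun v : ℝ => 1 + (u + v) ^ 2) (gaussianReal 0 1) := by
  have h : MemLp (fun v : ℝ => u + v) 2 (gaussianReal 0 1) :=
    (memLp_const u).add (memLp_id_gaussianReal 2)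
  exact (integrable_const _).add h.integrable_sq

lemma IsLevyMeasure.integrable_levyExponent_add {ν : Measure ℝ} (hν : IsLevyMeasure ν)
    (σ2 : ℝ≥0) (d u : ℝ) :
    Integrable (fun v => levyExponent ν σ2 d (u + v)) (gaussianReal 0 1) := by
  refine ((integrable_one_add_sq_gaussianReal u).const_mul _).mono'
    ((hν.measurable_levyExponent σ2 d).comp (measurable_const.add measurable_id)).aestronglyMeasurable
    (ae_of_all _ fun v => hν.norm_levyExponent_le σ2 d (u + v))

lemma IsLevyMeasure.integrable_gaussWeight {ν : Measure ℝ} (hν : IsLevyMeasure ν) :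
    Integrable gaussWeight ν :=
  hν.integrable_min.mono' continuous_gaussWeight.aestronglyMeasurable (ae_of_all _ fun x => by
    rw [Real.norm_of_nonneg (gaussWeight_nonneg x)]; exact gaussWeight_le_min x)

lemma integrable_id_gaussianReal_complex :
    Integrable (fun v : ℝ => (v : ℂ)) (gaussianReal 0 1) :=
  ((memLp_id_gaussianReal 1).integrable le_rfl).ofReal

lemma integral_id_gaussianReal_complex :
    ∫ v : ℝ, (v : ℂ) ∂(gaussianReal 0 1) = 0 := by
  rw [integral_complex_ofReal, integral_id_gaussianReal]; simp

lemma integral_sq_gaussianReal_complex :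
    ∫ v : ℝ, (v : ℂ) ^ 2 ∂(gaussianReal 0 1) = 1 := by
  have h := variance_fun_id_gaussianReal (μ := 0) (v := 1)
  rw [variance_of_integral_eq_zero (by fun_prop) (by simp)] at h
  have h2 : ∫ v : ℝ, ((v ^ 2 : ℝ) : ℂ) ∂(gaussianReal 0 1) = 1 := by
    rw [integral_complex_ofReal, h]; simp
  simpa using h2

lemma integrable_sq_gaussianReal_complex :
    Integrable (fun v : ℝ => (v : ℂ) ^ 2) (gaussianReal 0 1) := by
  have := (memLp_id_gaussianReal (μ := 0) (v := 1) 2).integrable_sq.ofReal (𝕜 := ℂ)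
  simpa using this

/-- The compensator contributes a term linear in `v`, which a centred Gaussian averages to zero. -/
lemma integral_expRem_sub_gaussianReal (u x : ℝ) :
    ∫ v : ℝ, (expRem (Complex.I * u) x - expRem (Complex.I * (u + v : ℝ)) x) ∂(gaussianReal 0 1) =
      Complex.exp (u * x * Complex.I) * gaussWeight x := by
  have h1 : ∀ v : ℝ, expRem (Complex.I * u) x - expRem (Complex.I * (u + v : ℝ)) x =
      (Complex.exp (u * x * Complex.I) - Complex.exp (u * x * Complex.I) *
        Complex.exp (x * v * Complex.I)) + (if |x| < 1 then Complex.I * x else 0) * v := by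
    intro v
    rw [← Complex.exp_add]
    unfold expRem
    have e1 : Complex.I * (u : ℂ) * x = u * x * Complex.I := by ring
    have e2 : Complex.I * ((u + v : ℝ) : ℂ) * x = u * x * Complex.I + x * v * Complex.I := by
      push_cast; ring
    rw [e1, e2]
    split_ifs <;> ring
  simp_rw [h1]
  have hi : Integrable (fun v : ℝ => Complex.exp (x * v * Complex.I)) (gaussianReal 0 1) := by
    refine (integrable_const (1 : ℝ)).mono' (by fun_prop) (ae_of_all _ fun q => ?_)
    rw [norm_exp_ofReal_mul_ofReal_mul_I]
  rw [integral_add, integral_sub (integrable_const _) (hi.const_mul _), integral_const_mul, integral_const_mul, integral_exp_gaussianReal,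
    integral_id_gaussianReal_complex]
  · simp [gaussWeight]
    ring
  · exact (integrable_const _).sub (hi.const_mul _)
  · exact integrable_id_gaussianReal_complex.const_mul _

/-- The same averaging applied to the Lévy exponent: terms linear in `v` vanish, and the quadratic
one leaves `σ2 / 2` because the Gaussian has variance 1. -/
lemma IsLevyMeasure.integral_exp_mul_gaussWeight {ν : Measure ℝ} (hν : IsLevyMeasure ν)
    (σ2 : ℝ≥0) (d u : ℝ) :
    ∫ x, Complex.exp (u * x * Complex.I) * gaussWeight x ∂ν + (σ2 : ℝ) / 2 =
      ∫ v, (levyExponent ν σ2 d u - levyExponent ν σ2 d (u + v)) ∂(gaussianReal 0 1) := by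
  have := hν.sigmaFinite
  have hi : Integrable (fun q : ℝ × ℝ => expRem (Complex.I * u) q.2 -
      expRem (Complex.I * (u + q.1 : ℝ)) q.2) ((gaussianReal 0 1).prod ν) := by
    refine Integrable.sub ?_ ?_
    · exact (hν.integrable_expRem_I u).comp_snd _
    · have hb := (integrable_one_add_sq_gaussianReal u).mul_prod hν.integrable_min
      refine (hb.const_mul 3).mono' ?_ (ae_of_all _ fun q => ?_)
      · exact (measurable_expRem.comp (by fun_prop : Measurable fun q : ℝ × ℝ =>
          ((Complex.I * (u + q.1 : ℝ) : ℂ), q.2))).aestronglyMeasurable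
      · rw [← mul_assoc]; exact norm_expRem_I_le _ _
  have h1 : ∀ v : ℝ, levyExponent ν σ2 d u - levyExponent ν σ2 d (u + v) =
      (-(d * Complex.I) + σ2 * u : ℂ) * v + ((σ2 : ℝ) / 2 : ℂ) * (v : ℂ) ^ 2 +
        ∫ x, (expRem (Complex.I * u) x - expRem (Complex.I * (u + v : ℝ)) x) ∂ν := by
    intro v
    rw [integral_sub (hν.integrable_expRem_I u) (hν.integrable_expRem_I _),
      levyExponent_eq_laplaceExponent, levyExponent_eq_laplaceExponent]
    unfold laplaceExponent
    simp only [mul_pow, Complex.I_sq]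
    push_cast
    ring
  simp_rw [h1]
  rw [integral_add, integral_add, integral_const_mul, integral_const_mul,
    integral_id_gaussianReal_complex, integral_sq_gaussianReal_complex, integral_integral_swap hi]
  · simp_rw [integral_expRem_sub_gaussianReal]
    ring
  · exact integrable_id_gaussianReal_complex.const_mul _
  · exact integrable_sq_gaussianReal_complex.const_mul _
  · exact (integrable_id_gaussianReal_complex.const_mul _).add
      (integrable_sq_gaussianReal_complex.const_mul _)
  · exact hi.integral_prod_left

lemma IsLevyMarginals.charFun_inv {ν : Measure ℝ} {σ2 : ℝ≥0} {d : ℝ}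
    {p : ℝ≥0 → Measure ℝ} (h : IsLevyMarginals ν σ2 d p) (n : ℕ) (u : ℝ) :
    charFun (p (n : ℝ≥0)⁻¹) u = Complex.exp (levyExponent ν σ2 d u / n) := by
  rw [h.charFun_eq]
  congr 1
  push_cast
  ring

/-- Small-time asymptotics in Fourier form: `n (e^{ψ/n} - 1) → ψ`, with domination because the
exponent has nonpositive real part. In terms of measures, `n * gaussWeight • p (1/n)` tends to
`gaussWeight • ν` plus an atom `σ2 / 2` at `0`. -/
lemma IsLevyMarginals.tendsto_integral_exp_mul_gaussWeight {ν : Measure ℝ} {σ2 : ℝ≥0} {d : ℝ}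
    {p : ℝ≥0 → Measure ℝ} (h : IsLevyMarginals ν σ2 d p) (u : ℝ) :
    Tendsto (fun n : ℕ => (n : ℂ) * ∫ x, Complex.exp (u * x * Complex.I) * gaussWeight x
      ∂(p (n : ℝ≥0)⁻¹)) atTop
      (𝓝 (∫ x, Complex.exp (u * x * Complex.I) * gaussWeight x ∂ν + (σ2 : ℝ) / 2)) := by
  have hν := h.levyMeasure
  have h0 : ∀ n : ℕ, (n : ℂ) * ∫ x, Complex.exp (u * x * Complex.I) * gaussWeight x
      ∂(p (n : ℝ≥0)⁻¹) = ∫ v, ((n : ℂ) * (Complex.exp (levyExponent ν σ2 d u / n) - 1) -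
        (n : ℂ) * (Complex.exp (levyExponent ν σ2 d (u + v) / n) - 1)) ∂(gaussianReal 0 1) := by
    intro n
    have := h.prob (n : ℝ≥0)⁻¹
    rw [LBR.integral_exp_mul_gaussWeight, ← integral_const_mul]
    refine integral_congr_ae (ae_of_all _ fun v => ?_)
    simp only [h.charFun_inv]
    ring
  simp_rw [h0]
  rw [hν.integral_exp_mul_gaussWeight σ2 d u]
  refine tendsto_integral_of_dominated_convergence
    (fun v => ‖levyExponent ν σ2 d u‖ + ‖levyExponent ν σ2 d (u + v)‖) ?_ ?_ ?_ ?_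
  · intro n
    have := hν.measurable_levyExponent σ2 d
    exact Measurable.aestronglyMeasurable (by fun_prop)
  · exact (integrable_const _).add (hν.integrable_levyExponent_add σ2 d u).norm
  · intro n
    refine ae_of_all _ fun v => (norm_sub_le _ _).trans (add_le_add ?_ ?_)
    · exact norm_nat_mul_exp_div_sub_one_le (h.re_levyExponent_nonpos u) n
    · exact norm_nat_mul_exp_div_sub_one_le (h.re_levyExponent_nonpos _) n
  · exact ae_of_all _ fun v => (tendsto_nat_mul_exp_div_sub_one _).sub
      (tendsto_nat_mul_exp_div_sub_one _)

/-- The probability measure `C⁻¹ (1 - e^{-x²/2}) μ(dx)`, completed by an atom at `0`. -/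
def gaussTilt (μ : Measure ℝ) (C : ℝ) : Measure ℝ :=
  μ.withDensity (fun x => ENNReal.ofReal (gaussWeight x / C)) +
    ENNReal.ofReal (1 - (∫ x, gaussWeight x ∂μ) / C) • Measure.dirac 0

lemma lintegral_gaussTilt {μ : Measure ℝ} {C : ℝ} {f : ℝ → ℝ≥0∞}
    (hf : Measurable f) :
    ∫⁻ x, f x ∂(gaussTilt μ C) = ∫⁻ x, ENNReal.ofReal (gaussWeight x / C) * f x ∂μ +
      ENNReal.ofReal (1 - (∫ x, gaussWeight x ∂μ) / C) * f 0 := by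
  have hm : Measurable fun x => ENNReal.ofReal (gaussWeight x / C) := by
    have := continuous_gaussWeight.measurable
    fun_prop
  rw [gaussTilt, lintegral_add_measure, lintegral_smul_measure, lintegral_dirac' _ hf,
    lintegral_withDensity_eq_lintegral_mul _ hm hf]
  rfl

lemma isProbabilityMeasure_gaussTilt {μ : Measure ℝ} {C : ℝ} (hC : 0 < C)
    (hi : Integrable gaussWeight μ) (hle : ∫ x, gaussWeight x ∂μ ≤ C) :
    IsProbabilityMeasure (gaussTilt μ C) := by
  constructor
  rw [← lintegral_one, lintegral_gaussTilt (f := fun _ => 1) measurable_const]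
  simp only [mul_one]
  rw [← ofReal_integral_eq_lintegral_ofReal (hi.div_const C)
    (ae_of_all _ fun x => div_nonneg (gaussWeight_nonneg x) hC.le), integral_div,
    ← ENNReal.ofReal_add (div_nonneg (integral_nonneg gaussWeight_nonneg) hC.le)
    (sub_nonneg.2 ((div_le_one hC).2 hle))]
  simp

lemma charFun_gaussTilt {μ : Measure ℝ} {C : ℝ} (hC : 0 < C)
    (hi : Integrable gaussWeight μ) (hle : ∫ x, gaussWeight x ∂μ ≤ C) (u : ℝ) :
    charFun (gaussTilt μ C) u =
      (∫ x, Complex.exp (u * x * Complex.I) * gaussWeight x ∂μ) / C +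
        (1 - (∫ x, gaussWeight x ∂μ) / C : ℝ) := by
  have := isProbabilityMeasure_gaussTilt hC hi hle
  have hm : Measurable fun x => ENNReal.ofReal (gaussWeight x / C) := by
    have := continuous_gaussWeight.measurable
    fun_prop
  have hI : Integrable (fun x : ℝ => Complex.exp (u * x * Complex.I)) (gaussTilt μ C) := by
    refine (integrable_const (1 : ℝ)).mono' (by fun_prop) (ae_of_all _ fun q => ?_)
    rw [norm_exp_ofReal_mul_ofReal_mul_I]
  rw [gaussTilt] at hI
  rw [charFun_apply_real, gaussTilt, integral_add_measure hI.left_of_add_measure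
    hI.right_of_add_measure, integral_smul_measure, integral_dirac,
    integral_withDensity_eq_integral_toReal_smul hm (ae_of_all _ fun _ => ENNReal.ofReal_lt_top),
    ENNReal.toReal_ofReal (sub_nonneg.2 ((div_le_one hC).2 hle)),
    ← integral_div (C : ℂ)]
  congr 1
  · refine integral_congr_ae (ae_of_all _ fun x => ?_)
    simp only
    rw [ENNReal.toReal_ofReal (div_nonneg (gaussWeight_nonneg x) hC.le), Complex.real_smul]
    push_cast
    ring
  · simp

lemma integral_gaussWeight_complex (μ : Measure ℝ) :
    ∫ x, Complex.exp ((0 : ℝ) * x * Complex.I) * gaussWeight x ∂μ =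
      ((∫ x, gaussWeight x ∂μ : ℝ) : ℂ) := by
  simp [integral_complex_ofReal]

section ExponentialMoment

variable {ν : Measure ℝ} {σ2 : ℝ≥0} {d : ℝ} {p : ℝ≥0 → Measure ℝ}

lemma integrable_gaussWeight_of_isFiniteMeasure (q : Measure ℝ) [IsFiniteMeasure q] :
    Integrable gaussWeight q :=
  (integrable_const (1 : ℝ)).mono' continuous_gaussWeight.aestronglyMeasurable
    (ae_of_all _ fun x => by
      rw [Real.norm_of_nonneg (gaussWeight_nonneg x)]; exact gaussWeight_le_one x)

lemma IsLevyMarginals.tendsto_integral_gaussWeight (h : IsLevyMarginals ν σ2 d p) :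
    Tendsto (fun n : ℕ => (n : ℝ) * ∫ x, gaussWeight x ∂(p (n : ℝ≥0)⁻¹)) atTop
      (𝓝 (∫ x, gaussWeight x ∂ν + σ2 / 2)) := by
  have := h.tendsto_integral_exp_mul_gaussWeight 0
  simp_rw [integral_gaussWeight_complex] at this
  convert! (Complex.continuous_re.tendsto _).comp this using 1
  · ext n
    simp
  · norm_cast

lemma IsLevyMarginals.exists_forall_integral_gaussWeight_le (h : IsLevyMarginals ν σ2 d p) :
    ∃ C : ℝ, 0 < C ∧ (∀ n : ℕ, (n : ℝ) * ∫ x, gaussWeight x ∂(p (n : ℝ≥0)⁻¹) ≤ C) ∧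
      ∫ x, gaussWeight x ∂ν ≤ C := by
  obtain ⟨C, hC⟩ := h.tendsto_integral_gaussWeight.bddAbove_range
  have hC' : ∀ n : ℕ, (n : ℝ) * ∫ x, gaussWeight x ∂(p (n : ℝ≥0)⁻¹) ≤ C :=
    fun n => hC (mem_range_self n)
  have h0 : 0 ≤ C := by simpa using hC' 0
  refine ⟨C + 1, by linarith, fun n => (hC' n).trans (by linarith), ?_⟩
  have := le_of_tendsto' h.tendsto_integral_gaussWeight hC'
  linarith [σ2.coe_nonneg]

/-- Completing all measures to mass one makes them comparable as probability measures. The atom `σ2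
/ 2` created in the limit is exactly offset by the loss in the completing atom, so `σ2` is absent
from the limit. -/
lemma IsLevyMarginals.tendsto_charFun_gaussTilt (h : IsLevyMarginals ν σ2 d p) {C : ℝ}
    (hC : 0 < C) (hp : ∀ n : ℕ, (n : ℝ) * ∫ x, gaussWeight x ∂(p (n : ℝ≥0)⁻¹) ≤ C)
    (hν : ∫ x, gaussWeight x ∂ν ≤ C) (u : ℝ) :
    Tendsto (fun n : ℕ => charFun (gaussTilt ((n : ℝ≥0) • p (n : ℝ≥0)⁻¹) C) u) atTop
      (𝓝 (charFun (gaussTilt ν C) u)) := by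
  have h1 := h.tendsto_integral_exp_mul_gaussWeight u
  have h2 := (Complex.continuous_ofReal.tendsto _).comp h.tendsto_integral_gaussWeight
  have h3 := (h1.div_const (C : ℂ)).add ((h2.div_const (C : ℂ)).const_sub 1)
  rw [charFun_gaussTilt hC h.levyMeasure.integrable_gaussWeight hν]
  convert h3 using 1
  · ext n
    have := h.prob (n : ℝ≥0)⁻¹
    rw [charFun_gaussTilt hC (integrable_gaussWeight_of_isFiniteMeasure _)
      (by rw [integral_smul_nnreal_measure, NNReal.smul_def]; simpa using hp n),
      integral_smul_nnreal_measure, integral_smul_nnreal_measure]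
    simp [NNReal.smul_def]
  · congr 1
    push_cast
    ring

/-- A bound uniform in `n` on exponential moments of the approximating measures, obtained by
integrating `exp_mul_gaussWeight_le`. -/
lemma IsLevyMarginals.integral_exp_mul_gaussWeight_le (h : IsLevyMarginals ν σ2 d p) {θ C : ℝ}
    (hθ : 0 ≤ θ)
    (hi : ∀ t, Integrable (fun x : ℝ => Real.exp x) (p t))
    (hle : ∀ t : ℝ≥0, ∫ x, Real.exp x ∂(p t) ≤ Real.exp (θ * t))
    (hp : ∀ n : ℕ, (n : ℝ) * ∫ x, gaussWeight x ∂(p (n : ℝ≥0)⁻¹) ≤ C) (n : ℕ) :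
    (n : ℝ) * ∫ x, Real.exp x * gaussWeight x ∂(p (n : ℝ≥0)⁻¹) ≤
      5 * (θ * Real.exp θ + ‖levyExponent ν σ2 d 1‖ + 7 * C) := by
  rcases Nat.eq_zero_or_pos n with rfl | hn
  · have := hp 0
    simp only [Nat.cast_zero, zero_mul] at this ⊢
    positivity
  have hn' : (1 : ℝ) ≤ n := by exact_mod_cast hn
  set q := p (n : ℝ≥0)⁻¹ with hq
  have := h.prob (n : ℝ≥0)⁻¹
  have hw := integrable_gaussWeight_of_isFiniteMeasure q
  have hsin : Integrable Real.sin q := (integrable_const (1 : ℝ)).mono' (by fun_prop)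
    (ae_of_all _ fun x => Real.abs_sin_le_one x)
  have hexp : Integrable (fun x => Real.exp x) q := hi _
  have h1 : ∫ x, Real.exp x * gaussWeight x ∂q ≤
      5 * (∫ x, Real.exp x ∂q - 1 - ∫ x, Real.sin x ∂q + 7 * ∫ x, gaussWeight x ∂q) := by
    have hr : Integrable (fun x => 5 * (Real.exp x - 1 - Real.sin x + 7 * gaussWeight x)) q :=
      (((hexp.sub (integrable_const _)).sub hsin).add (hw.const_mul 7)).const_mul 5
    calc _ ≤ ∫ x, 5 * (Real.exp x - 1 - Real.sin x + 7 * gaussWeight x) ∂q := by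
          refine integral_mono_of_nonneg (ae_of_all _ fun x => ?_) hr
            (ae_of_all _ exp_mul_gaussWeight_le)
          exact mul_nonneg (Real.exp_pos x).le (gaussWeight_nonneg x)
      _ = _ := by
          have e1 : Integrable (fun x => Real.exp x - 1) q := hexp.sub (integrable_const _)
          have e2 : Integrable (fun x => Real.exp x - 1 - Real.sin x) q := e1.sub hsin
          rw [integral_const_mul, integral_add e2 (hw.const_mul 7), integral_sub e1 hsin,
            integral_sub hexp (integrable_const _), integral_const_mul]
          simp
  -- The exponential moment at time `1 / n` is at most `e^{θ/n}`, and `e^a - 1 ≤ a e^a`.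
  have h2 : (n : ℝ) * (∫ x, Real.exp x ∂q - 1) ≤ θ * Real.exp θ := by
    have h3 : ∫ x, Real.exp x ∂q ≤ Real.exp (θ / n) := by
      have := hle (n : ℝ≥0)⁻¹
      rwa [NNReal.coe_inv, NNReal.coe_natCast, ← div_eq_mul_inv] at this
    have h4 : Real.exp (θ / n) - 1 ≤ θ / n * Real.exp (θ / n) := by
      have := Real.add_one_le_exp (-(θ / n))
      have h5 : Real.exp (θ / n) * Real.exp (-(θ / n)) = 1 := by rw [← Real.exp_add]; simp
      nlinarith [Real.exp_pos (θ / n)]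
    have h6 : Real.exp (θ / n) ≤ Real.exp θ :=
      Real.exp_le_exp.2 (div_le_self hθ hn')
    calc _ ≤ (n : ℝ) * (θ / n * Real.exp θ) := by
          gcongr
          linarith [mul_le_mul_of_nonneg_left h6 (by positivity : 0 ≤ θ / n)]
      _ = _ := by field_simp
  have h3 : -((n : ℝ) * ∫ x, Real.sin x ∂q) ≤ ‖levyExponent ν σ2 d 1‖ := by
    have e : ∫ x, Real.sin x ∂q = (charFun q 1 - 1).im := by
      have hI : Integrable (fun x : ℝ => Complex.exp ((1 : ℝ) * x * Complex.I)) q := by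
        refine (integrable_const (1 : ℝ)).mono' (by fun_prop) (ae_of_all _ fun y => ?_)
        rw [norm_exp_ofReal_mul_ofReal_mul_I]
      have := integral_im hI
      rw [charFun_apply_real, Complex.sub_im, Complex.one_im, sub_zero]
      refine Eq.trans ?_ this
      refine integral_congr_ae (ae_of_all _ fun x => ?_)
      simp [Complex.exp_ofReal_mul_I_im]
    have e2 := norm_nat_mul_exp_div_sub_one_le (h.re_levyExponent_nonpos 1) n
    rw [← h.charFun_inv, norm_mul, Complex.norm_natCast] at e2
    have e3 := Complex.abs_im_le_norm (charFun q 1 - 1)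
    rw [e, ← mul_neg]
    refine le_trans ?_ e2
    gcongr
    exact (neg_le_abs _).trans e3
  have := hp n
  calc _ ≤ (n : ℝ) * (5 * (∫ x, Real.exp x ∂q - 1 - ∫ x, Real.sin x ∂q
        + 7 * ∫ x, gaussWeight x ∂q)) := by gcongr
    _ ≤ _ := by linarith

/-- Exponential moments of the marginals are inherited by the Lévy measure. -/
theorem IsLevyMarginals.integrable_min_mul_one_add_exp (h : IsLevyMarginals ν σ2 d p) {θ : ℝ}
    (hθ : 0 ≤ θ)
    (hi : ∀ t, Integrable (fun x : ℝ => Real.exp x) (p t))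
    (hle : ∀ t : ℝ≥0, ∫ x, Real.exp x ∂(p t) ≤ Real.exp (θ * t)) :
    Integrable (fun x : ℝ => min 1 (x ^ 2) * (1 + Real.exp x)) ν := by
  obtain ⟨C, hC, hp, hν⟩ := h.exists_forall_integral_gaussWeight_le
  have hprob : ∀ n : ℕ, IsProbabilityMeasure (gaussTilt ((n : ℝ≥0) • p (n : ℝ≥0)⁻¹) C) := by
    intro n
    have := h.prob (n : ℝ≥0)⁻¹
    exact isProbabilityMeasure_gaussTilt hC (integrable_gaussWeight_of_isFiniteMeasure _)
      (by rw [integral_smul_nnreal_measure, NNReal.smul_def]; simpa using hp n)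
  have hprob0 : IsProbabilityMeasure (gaussTilt ν C) :=
    isProbabilityMeasure_gaussTilt hC h.levyMeasure.integrable_gaussWeight hν
  let ρ : ℕ → ProbabilityMeasure ℝ := fun n => ⟨gaussTilt ((n : ℝ≥0) • p (n : ℝ≥0)⁻¹) C, hprob n⟩
  let ρ' : ProbabilityMeasure ℝ := ⟨gaussTilt ν C, hprob0⟩
  -- Lévy's continuity theorem; the portmanteau inequality for open sets then gives a Fatou lemma
  -- for the unbounded continuous function `exp`.
  have hconv : Tendsto ρ atTop (𝓝 ρ') :=
    ProbabilityMeasure.tendsto_iff_tendsto_charFun.2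
      fun u => h.tendsto_charFun_gaussTilt hC hp hν u
  have hopen : ∀ G, IsOpen G → gaussTilt ν C G ≤
      atTop.liminf (fun n : ℕ => gaussTilt ((n : ℝ≥0) • p (n : ℝ≥0)⁻¹) C G) :=
    fun G hG => ProbabilityMeasure.le_liminf_measure_open_of_tendsto hconv hG
  have hl := lintegral_le_liminf_lintegral_of_forall_isOpen_measure_le_liminf_measure
    (f := fun x => Real.exp x) Real.continuous_exp (fun x => (Real.exp_pos x).le) hopen
  set B := 5 * (θ * Real.exp θ + ‖levyExponent ν σ2 d 1‖ + 7 * C) with hB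
  have hbound : ∀ n : ℕ, ∫⁻ x, ENNReal.ofReal (Real.exp x)
      ∂(gaussTilt ((n : ℝ≥0) • p (n : ℝ≥0)⁻¹) C) ≤ ENNReal.ofReal (B / C) + 1 := by
    intro n
    have := h.prob (n : ℝ≥0)⁻¹
    rw [lintegral_gaussTilt (by fun_prop)]
    refine add_le_add ?_ ?_
    · have e : ∀ x, ENNReal.ofReal (gaussWeight x / C) * ENNReal.ofReal (Real.exp x) =
          ENNReal.ofReal (Real.exp x * gaussWeight x / C) := fun x => by
        rw [← ENNReal.ofReal_mul (div_nonneg (gaussWeight_nonneg x) hC.le)]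
        ring_nf
      simp_rw [e]
      have hint : Integrable (fun x => Real.exp x * gaussWeight x) (p (n : ℝ≥0)⁻¹) :=
        (hi _).mono' (Real.continuous_exp.mul continuous_gaussWeight).aestronglyMeasurable
          (ae_of_all _ fun x => by
            rw [Real.norm_of_nonneg (mul_nonneg (Real.exp_pos x).le (gaussWeight_nonneg x))]
            exact mul_le_of_le_one_right (Real.exp_pos x).le (gaussWeight_le_one x))
      have hint' : Integrable (fun x => Real.exp x * gaussWeight x / C)
        ((n : ℝ≥0) • p (n : ℝ≥0)⁻¹) := (hint.div_const C).smul_measure_nnreal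
      rw [← ofReal_integral_eq_lintegral_ofReal hint' (ae_of_all _ fun x =>
          div_nonneg (mul_nonneg (Real.exp_pos x).le (gaussWeight_nonneg x)) hC.le),
        integral_smul_nnreal_measure, integral_div, NNReal.smul_def, smul_eq_mul,
        ← mul_div_assoc]
      refine ENNReal.ofReal_le_ofReal ?_
      gcongr
      exact h.integral_exp_mul_gaussWeight_le hθ hi hle hp n
    · simp only [Real.exp_zero, ENNReal.ofReal_one, mul_one, ENNReal.ofReal_le_one]
      have : 0 ≤ (∫ x, gaussWeight x ∂((n : ℝ≥0) • p (n : ℝ≥0)⁻¹)) / C :=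
        div_nonneg (integral_nonneg gaussWeight_nonneg) hC.le
      linarith
  have hfin : ∫⁻ x, ENNReal.ofReal (Real.exp x) ∂(gaussTilt ν C) < ∞ := by
    refine lt_of_le_of_lt (hl.trans ?_) (b := ENNReal.ofReal (B / C) + 1) (by simp)
    calc _ ≤ atTop.liminf (fun _ : ℕ => ENNReal.ofReal (B / C) + 1) :=
          liminf_le_liminf (Eventually.of_forall hbound)
      _ = _ := liminf_const _
  rw [lintegral_gaussTilt (by fun_prop)] at hfin
  have hwexp : Integrable (fun x => gaussWeight x / C * Real.exp x) ν := by
    refine ⟨((continuous_gaussWeight.div_const C).mul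
      Real.continuous_exp).aestronglyMeasurable, ?_⟩
    rw [hasFiniteIntegral_iff_ofReal (ae_of_all _ fun x =>
      mul_nonneg (div_nonneg (gaussWeight_nonneg x) hC.le) (Real.exp_pos x).le)]
    refine lt_of_eq_of_lt (lintegral_congr fun x => ?_)
      ((le_add_right le_rfl).trans_lt hfin)
    rw [ENNReal.ofReal_mul (div_nonneg (gaussWeight_nonneg x) hC.le)]
  refine (h.levyMeasure.integrable_min.add (hwexp.const_mul (3 * C))).mono'
    (by fun_prop) (ae_of_all _ fun x => ?_)
  rw [Real.norm_of_nonneg (by positivity)]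
  have hE := Real.exp_pos x
  have := mul_le_mul_of_nonneg_right (min_le_gaussWeight x) hE.le
  simp only [Pi.add_apply]
  have e : 3 * C * (gaussWeight x / C * Real.exp x) = 3 * gaussWeight x * Real.exp x := by
    field_simp
  rw [e]
  linarith

end ExponentialMoment

/-! ### Extension of the Lévy–Khintchine formula to the strip `0 ≤ Re z ≤ 1` -/

lemma norm_exp_mul_ofReal (z : ℂ) (x : ℝ) : ‖Complex.exp (z * x)‖ = Real.exp (z.re * x) := by
  rw [Complex.norm_exp]; simp

lemma closure_verticalStrip : closure (verticalStrip 0 1) = verticalClosedStrip 0 1 := by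
  unfold verticalStrip verticalClosedStrip
  rw [Complex.closure_preimage_re, closure_Ioo zero_ne_one]

lemma norm_exp_mul_le_of_mem_strip {z : ℂ} (hz : z ∈ verticalClosedStrip 0 1) (x : ℝ) :
    ‖Complex.exp (z * x)‖ ≤ 1 + Real.exp x := by
  rw [norm_exp_mul_ofReal]
  exact exp_mul_le_one_add_exp hz.1 hz.2 x

/-- The derivative in `z` of `expRem z x`. -/
def expRemDeriv (z : ℂ) (x : ℝ) : ℂ :=
  x * Complex.exp (z * x) - (if |x| < 1 then (x : ℂ) else 0)

lemma hasDerivAt_expRem (z : ℂ) (x : ℝ) :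
    HasDerivAt (fun w => expRem w x) (expRemDeriv z x) z := by
  have h1 : HasDerivAt (fun w : ℂ => w * x) x z := by
    simpa using (hasDerivAt_id z).mul_const (x : ℂ)
  have h2 := (h1.cexp).sub_const 1
  unfold expRem expRemDeriv
  split_ifs
  · convert! h2.sub h1 using 1
    ring
  · convert! h2.sub (hasDerivAt_const z (0 : ℂ)) using 1
    ring

lemma measurable_expRemDeriv (z : ℂ) : Measurable (expRemDeriv z) := by
  unfold expRemDeriv
  refine Measurable.sub (by fun_prop) (Measurable.ite ?_ (by fun_prop) measurable_const)
  exact measurableSet_lt (by fun_prop) measurable_const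

/-- Differentiation brings down a factor `x`, unbounded in the tails. A margin `ε` from both edges
of the strip absorbs it, since `|x| ≤ ε⁻¹ e^{ε|x|}`. -/
lemma norm_expRemDeriv_le {z : ℂ} {ε : ℝ} (hε : 0 < ε) (h0 : ε ≤ z.re) (h1 : z.re ≤ 1 - ε)
    (x : ℝ) :
    ‖expRemDeriv z x‖ ≤
      (‖z‖ * Real.exp ‖z‖ + ε⁻¹) * (min 1 (x ^ 2) * (1 + Real.exp x)) := by
  have hE : 0 < Real.exp x := Real.exp_pos x
  have hZ : 0 ≤ ‖z‖ * Real.exp ‖z‖ := by positivity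
  have hε' : 0 < ε⁻¹ := inv_pos.2 hε
  unfold expRemDeriv
  split_ifs with h
  · have hx : x ^ 2 ≤ 1 := by rw [← sq_abs]; nlinarith [abs_nonneg x]
    rw [min_eq_right hx]
    have h3 : ‖Complex.exp (z * x) - 1‖ ≤ ‖z * x‖ * Real.exp ‖z * x‖ := by
      have := Complex.norm_exp_sub_sum_le_norm_mul_exp (z * x) 1
      simpa using this
    rw [norm_mul, Complex.norm_real, Real.norm_eq_abs] at h3
    have h4 : Real.exp (‖z‖ * |x|) ≤ Real.exp ‖z‖ :=
      Real.exp_le_exp.2 (mul_le_of_le_one_right (norm_nonneg _) h.le)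
    have h5 : (x : ℂ) * Complex.exp (z * x) - x = x * (Complex.exp (z * x) - 1) := by ring
    rw [h5, norm_mul, Complex.norm_real, Real.norm_eq_abs]
    calc _ ≤ |x| * (‖z‖ * |x| * Real.exp ‖z‖) := by
          gcongr
          exact h3.trans (by gcongr)
      _ = (‖z‖ * Real.exp ‖z‖) * (x ^ 2 * 1) := by rw [← sq_abs]; ring
      _ ≤ _ := by gcongr <;> linarith
  · have hx : 1 ≤ x ^ 2 := by rw [← sq_abs]; nlinarith [not_lt.1 h]
    rw [min_eq_left hx, sub_zero, one_mul, norm_mul, norm_exp_mul_ofReal, Complex.norm_real,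
      Real.norm_eq_abs]
    have hx1 : |x| ≤ ε⁻¹ * Real.exp (ε * |x|) := by
      have := Real.add_one_le_exp (ε * |x|)
      rw [← div_eq_inv_mul, le_div_iff₀ hε]
      linarith
    have hx2 : Real.exp (ε * |x|) * Real.exp (z.re * x) ≤ 1 + Real.exp x := by
      rw [← Real.exp_add]
      rcases le_total 0 x with h' | h'
      · rw [abs_of_nonneg h']
        have : Real.exp (ε * x + z.re * x) ≤ Real.exp x := Real.exp_le_exp.2 (by nlinarith)
        linarith
      · rw [abs_of_nonpos h']
        have : Real.exp (ε * -x + z.re * x) ≤ 1 := Real.exp_le_one_iff.2 (by nlinarith)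
        linarith
    calc _ ≤ ε⁻¹ * Real.exp (ε * |x|) * Real.exp (z.re * x) := by gcongr
      _ = ε⁻¹ * (Real.exp (ε * |x|) * Real.exp (z.re * x)) := by ring
      _ ≤ ε⁻¹ * (1 + Real.exp x) := by gcongr
      _ ≤ _ := by gcongr; linarith

section Strip

variable {ν : Measure ℝ}

lemma integrable_expRem (hJ : Integrable (fun x : ℝ => min 1 (x ^ 2) * (1 + Real.exp x)) ν)
    {z : ℂ} (hz : z ∈ verticalClosedStrip 0 1) : Integrable (expRem z) ν :=
  (hJ.const_mul _).mono' (measurable_expRem_right z).aestronglyMeasurable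
    (ae_of_all _ fun x => norm_expRem_le hz.1 hz.2 x)

lemma continuousOn_integral_expRem
    (hJ : Integrable (fun x : ℝ => min 1 (x ^ 2) * (1 + Real.exp x)) ν) :
    ContinuousOn (fun z => ∫ x, expRem z x ∂ν) (verticalClosedStrip 0 1) := by
  intro z hz
  have hnear : ∀ᶠ w in 𝓝[verticalClosedStrip 0 1] z, ‖w‖ ≤ ‖z‖ + 1 :=
    (continuous_norm.continuousWithinAt.eventually_lt continuousWithinAt_const
      (by linarith : ‖z‖ < ‖z‖ + 1)).mono fun w hw => hw.le
  refine continuousWithinAt_of_dominated (bound := fun x =>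
    (2 + (‖z‖ + 1) ^ 2 * Real.exp (‖z‖ + 1)) * (min 1 (x ^ 2) * (1 + Real.exp x))) ?_ ?_
    (hJ.const_mul _) ?_
  · exact Eventually.of_forall fun w => (measurable_expRem_right w).aestronglyMeasurable
  · filter_upwards [hnear, self_mem_nhdsWithin] with w hw hw'
    refine ae_of_all _ fun x => (norm_expRem_le hw'.1 hw'.2 x).trans ?_
    gcongr
  · exact ae_of_all _ fun x => (hasDerivAt_expRem z x).continuousAt.continuousWithinAt

lemma differentiableOn_integral_expRem
    (hJ : Integrable (fun x : ℝ => min 1 (x ^ 2) * (1 + Real.exp x)) ν) :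
    DifferentiableOn ℂ (fun z => ∫ x, expRem z x ∂ν) (verticalStrip 0 1) := by
  intro z hz
  obtain ⟨hz0, hz1⟩ : 0 < z.re ∧ z.re < 1 := hz
  set ε := min z.re (1 - z.re) / 2 with hεd
  have hε : 0 < ε := by
    have : 0 < min z.re (1 - z.re) := lt_min hz0 (by linarith)
    positivity
  have hε0 : 2 * ε ≤ z.re := by rw [hεd]; linarith [min_le_left z.re (1 - z.re)]
  have hε1 : 2 * ε ≤ 1 - z.re := by rw [hεd]; linarith [min_le_right z.re (1 - z.re)]
  have := hasDerivAt_integral_of_dominated_loc_of_deriv_le (μ := ν) (𝕜 := ℂ)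
    (F := expRem) (F' := expRemDeriv) (x₀ := z) (s := Metric.ball z ε)
    (bound := fun x => ((‖z‖ + ε) * Real.exp (‖z‖ + ε) + ε⁻¹) *
      (min 1 (x ^ 2) * (1 + Real.exp x)))
    (Metric.ball_mem_nhds z hε)
    (Eventually.of_forall fun w => (measurable_expRem_right w).aestronglyMeasurable)
    (integrable_expRem hJ ⟨hz0.le, hz1.le⟩)
    (measurable_expRemDeriv z).aestronglyMeasurable
    (ae_of_all _ fun x w hw => by
      rw [Metric.mem_ball, dist_eq_norm] at hw
      have h1 := (Complex.abs_re_le_norm (w - z)).trans hw.le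
      rw [Complex.sub_re, abs_le] at h1
      have h2 : ‖w‖ ≤ ‖z‖ + ε := by
        have := norm_add_le z (w - z)
        rw [add_sub_cancel] at this
        linarith
      refine (norm_expRemDeriv_le hε (by linarith) (by linarith) x).trans ?_
      gcongr)
    (hJ.const_mul _)
    (ae_of_all _ fun x w _ => hasDerivAt_expRem w x)
  exact this.2.differentiableAt.differentiableWithinAt

lemma diffContOnCl_exp_mul_laplaceExponent
    (hJ : Integrable (fun x : ℝ => min 1 (x ^ 2) * (1 + Real.exp x)) ν) (σ2 : ℝ≥0) (d t : ℝ) :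
    DiffContOnCl ℂ (fun z => Complex.exp (t * laplaceExponent ν σ2 d z)) (verticalStrip 0 1) := by
  unfold laplaceExponent
  refine ⟨?_, ?_⟩
  · have := differentiableOn_integral_expRem hJ
    fun_prop
  · rw [closure_verticalStrip]
    have := continuousOn_integral_expRem hJ
    fun_prop

/-- The real part of the compensator depends only on `Re z`, and `|e^{zx}| = e^{x Re z}`. This
bounds the real part of the Laplace exponent uniformly on the strip, although its norm may grow with
`Im z`. -/
lemma re_expRem_le (z : ℂ) (x : ℝ) : (expRem z x).re ≤ (expRem (z.re : ℂ) x).re := by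
  unfold expRem
  have h1 : (Complex.exp (z * x)).re ≤ Real.exp (z.re * x) := by
    rw [← norm_exp_mul_ofReal]; exact Complex.re_le_norm _
  have h2 : (Complex.exp ((z.re : ℂ) * x)).re = Real.exp (z.re * x) := by
    exact_mod_cast Complex.exp_ofReal_re (z.re * x)
  split_ifs <;> simp [h2] <;> simpa using h1

lemma exists_forall_re_laplaceExponent_le
    (hJ : Integrable (fun x : ℝ => min 1 (x ^ 2) * (1 + Real.exp x)) ν) (σ2 : ℝ≥0) (d : ℝ) :
    ∃ B : ℝ, ∀ z ∈ verticalClosedStrip 0 1, (laplaceExponent ν σ2 d z).re ≤ B := by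
  refine ⟨|d| + σ2 + ∫ x, (2 + 1 ^ 2 * Real.exp 1) * (min 1 (x ^ 2) * (1 + Real.exp x)) ∂ν,
    fun z hz => ?_⟩
  obtain ⟨hz0, hz1⟩ : 0 ≤ z.re ∧ z.re ≤ 1 := hz
  have hzr : (z.re : ℂ) ∈ verticalClosedStrip 0 1 := by
    constructor <;> simpa
  unfold laplaceExponent
  rw [Complex.add_re, Complex.add_re]
  refine add_le_add (add_le_add ?_ ?_) ?_
  · have : ((d : ℂ) * z).re = d * z.re := by simp
    rw [this]
    calc _ ≤ |d| * z.re := by gcongr; exact le_abs_self d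
      _ ≤ _ := mul_le_of_le_one_right (abs_nonneg d) hz1
  · have : (((σ2 : ℝ) : ℂ) * z ^ 2 / 2).re = σ2 * (z.re ^ 2 - z.im ^ 2) / 2 := by
      simp [pow_two, Complex.mul_re, Complex.mul_im]
    rw [this]
    nlinarith [mul_nonneg σ2.coe_nonneg (sq_nonneg z.im),
      mul_le_mul_of_nonneg_left (by nlinarith : z.re ^ 2 ≤ 1) σ2.coe_nonneg, σ2.coe_nonneg]
  · have e : (∫ x, expRem z x ∂ν).re = ∫ x, (expRem z x).re ∂ν :=
      (integral_re (integrable_expRem hJ ⟨hz0, hz1⟩)).symm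
    rw [e]
    refine integral_mono (integrable_expRem hJ ⟨hz0, hz1⟩).re (hJ.const_mul _) fun x => ?_
    refine (re_expRem_le z x).trans ((Complex.re_le_norm _).trans
      ((norm_expRem_le hzr.1 hzr.2 x).trans ?_))
    have : ‖(z.re : ℂ)‖ ≤ 1 := by
      rw [Complex.norm_real, Real.norm_of_nonneg hz0]; exact hz1
    gcongr

lemma integrable_one_add_exp {μ : Measure ℝ} [IsFiniteMeasure μ]
    (hi : Integrable (fun x : ℝ => Real.exp x) μ) :
    Integrable (fun x : ℝ => 1 + Real.exp x) μ := (integrable_const _).add hi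

lemma diffContOnCl_integral_exp {μ : Measure ℝ} [IsFiniteMeasure μ]
    (hi : Integrable (fun x : ℝ => Real.exp x) μ) :
    DiffContOnCl ℂ (fun z => ∫ x : ℝ, Complex.exp (z * x) ∂μ) (verticalStrip 0 1) := by
  refine ⟨?_, ?_⟩
  · have h : Icc (0 : ℝ) 1 ⊆ integrableExpSet id μ := by
      intro a ha
      refine (integrable_one_add_exp hi).mono' (by fun_prop) (ae_of_all _ fun x => ?_)
      rw [Real.norm_of_nonneg (Real.exp_pos _).le]
      exact exp_mul_le_one_add_exp ha.1 ha.2 x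
    refine (differentiableOn_complexMGF (X := id) (μ := μ)).mono fun z hz => ?_
    have := interior_mono h
    rw [interior_Icc] at this
    exact this hz
  · rw [closure_verticalStrip]
    refine continuousOn_of_dominated (fun z _ => by fun_prop)
      (fun z hz => ae_of_all _ fun x => norm_exp_mul_le_of_mem_strip hz x)
      (integrable_one_add_exp hi) (ae_of_all _ fun x => by fun_prop)

/-- The Lévy–Khintchine formula on the strip `0 ≤ Re z ≤ 1`. -/
theorem IsLevyMarginals.integral_exp_eq {σ2 : ℝ≥0} {d : ℝ} {p : ℝ≥0 → Measure ℝ}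
    (h : IsLevyMarginals ν σ2 d p)
    (hJ : Integrable (fun x : ℝ => min 1 (x ^ 2) * (1 + Real.exp x)) ν) (t : ℝ≥0)
    (hi : Integrable (fun x : ℝ => Real.exp x) (p t)) {z : ℂ} (hz : z ∈ verticalClosedStrip 0 1) :
    ∫ x : ℝ, Complex.exp (z * x) ∂(p t) =
      Complex.exp ((t : ℝ) * laplaceExponent ν σ2 d z) := by
  have := h.prob t
  have hd1 := diffContOnCl_integral_exp hi
  have hd2 := diffContOnCl_exp_mul_laplaceExponent hJ σ2 d t
  obtain ⟨B, hB⟩ := exists_forall_re_laplaceExponent_le hJ σ2 d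
  set F : ℂ → ℂ := fun z => ∫ x : ℝ, Complex.exp (z * x) ∂(p t) -
    Complex.exp ((t : ℝ) * laplaceExponent ν σ2 d z) with hF
  have hbound : ∀ z ∈ verticalClosedStrip 0 1,
      ‖F z‖ ≤ ∫ x, (1 + Real.exp x) ∂(p t) + Real.exp (t * B) := by
    intro z hz
    refine (norm_sub_le _ _).trans (add_le_add ?_ ?_)
    · exact norm_integral_le_of_norm_le (integrable_one_add_exp hi)
        (ae_of_all _ fun x => norm_exp_mul_le_of_mem_strip hz x)
    · rw [Complex.norm_exp, Complex.re_ofReal_mul]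
      exact Real.exp_le_exp.2 (mul_le_mul_of_nonneg_left (hB z hz) t.coe_nonneg)
  have hleft : ∀ z ∈ Complex.re ⁻¹' {0}, ‖F z‖ ≤ 0 := by
    intro z hz
    have hz' : z = Complex.I * (z.im : ℂ) := by
      apply Complex.ext
      · simpa using hz
      · simp
    rw [hz', norm_le_zero_iff, hF]
    simp only
    rw [← levyExponent_eq_laplaceExponent, ← h.charFun_eq, charFun_apply_real, sub_eq_zero]
    congr 1
    ext x
    ring_nf
  have hzero : ∀ z ∈ verticalStrip 0 1, F z = 0 := by
    intro z hz
    have hzc : z ∈ verticalClosedStrip 0 1 := ⟨hz.1.le, hz.2.le⟩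
    -- Hadamard's three lines theorem with bound `0` on the left edge: the interpolated bound
    -- contains `0 ^ (1 - Re z)`, which vanishes for `Re z < 1`. The right edge, the one needed
    -- later, follows by continuity.
    have := norm_le_interp_of_mem_verticalClosedStrip₀₁' F hzc (hd1.sub hd2)
      ⟨_, forall_mem_image.2 hbound⟩ hleft
      (fun z hz => hbound z ⟨by rw [show z.re = 1 from hz]; exact zero_le_one, (show z.re = 1 from hz).le⟩)
    rw [Real.zero_rpow (by linarith [show z.re < 1 from hz.2]), zero_mul] at this
    exact norm_le_zero_iff.1 this
  have hcl : EqOn F 0 (verticalClosedStrip 0 1) := by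
    refine EqOn.of_subset_closure hzero ?_ continuousOn_const
      (fun w hw => ⟨hw.1.le, hw.2.le⟩) closure_verticalStrip.ge
    have := (hd1.sub hd2).continuousOn
    rwa [closure_verticalStrip] at this
  exact sub_eq_zero.1 (hcl hz)

end Strip

/-! ### Reflected exponential tilting -/

lemma measurable_ofReal_exp : Measurable fun x : ℝ => ENNReal.ofReal (Real.exp x) := by fun_prop

lemma measurableEmbedding_neg_real : MeasurableEmbedding fun x : ℝ => -x :=
  (MeasurableEquiv.neg ℝ).measurableEmbedding

lemma lintegral_reversedLevyMeasure (μ : Measure ℝ) {f : ℝ → ℝ≥0∞} (hf : Measurable f) :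
    ∫⁻ x, f x ∂(reversedLevyMeasure μ) = ∫⁻ x, ENNReal.ofReal (Real.exp x) * f (-x) ∂μ := by
  unfold reversedLevyMeasure
  rw [lintegral_map hf measurable_neg,
    lintegral_withDensity_eq_lintegral_mul _ measurable_ofReal_exp (by fun_prop)]
  rfl

lemma integral_reversedLevyMeasure {E : Type*} [NormedAddCommGroup E] [NormedSpace ℝ E]
    (μ : Measure ℝ) (f : ℝ → E) :
    ∫ x, f x ∂(reversedLevyMeasure μ) = ∫ x, Real.exp x • f (-x) ∂μ := by
  unfold reversedLevyMeasure
  rw [measurableEmbedding_neg_real.integral_map,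
    integral_withDensity_eq_integral_toReal_smul measurable_ofReal_exp
      (ae_of_all _ fun _ => ENNReal.ofReal_lt_top)]
  refine integral_congr_ae (ae_of_all _ fun x => ?_)
  simp [ENNReal.toReal_ofReal (Real.exp_pos x).le]

lemma integrable_reversedLevyMeasure_iff {μ : Measure ℝ} {f : ℝ → ℝ} :
    Integrable f (reversedLevyMeasure μ) ↔ Integrable (fun x => Real.exp x * f (-x)) μ := by
  unfold reversedLevyMeasure
  rw [measurableEmbedding_neg_real.integrable_map_iff,
    integrable_withDensity_iff_integrable_smul' measurable_ofReal_exp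
      (ae_of_all _ fun _ => ENNReal.ofReal_lt_top)]
  refine integrable_congr (ae_of_all _ fun x => ?_)
  simp [ENNReal.toReal_ofReal (Real.exp_pos x).le]

lemma reversedLevyMeasure_smul (c : ℝ≥0∞) (μ : Measure ℝ) :
    reversedLevyMeasure (c • μ) = c • reversedLevyMeasure μ := by
  unfold reversedLevyMeasure
  rw [withDensity_smul_measure, Measure.map_smul]

section Tilt

variable {ν : Measure ℝ}

lemma isLevyMeasure_reversedLevyMeasure (hν : IsLevyMeasure ν)
    (hJ : Integrable (fun x : ℝ => min 1 (x ^ 2) * (1 + Real.exp x)) ν) :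
    IsLevyMeasure (reversedLevyMeasure ν) := by
  constructor
  · unfold reversedLevyMeasure
    rw [Measure.map_apply measurable_neg (measurableSet_singleton 0)]
    refine withDensity_absolutelyContinuous _ _ ?_
    have : (fun x : ℝ => -x) ⁻¹' {0} = {0} := by ext; simp
    rw [this, hν.1]
  · rw [lintegral_reversedLevyMeasure _ (by fun_prop)]
    refine lt_of_le_of_lt (lintegral_mono fun x => ?_) hJ.lintegral_lt_top
    rw [← ENNReal.ofReal_mul (Real.exp_pos x).le, neg_sq]
    refine ENNReal.ofReal_le_ofReal ?_
    have : 0 ≤ min 1 (x ^ 2) := by positivity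
    nlinarith

/-- The integrand of the change of drift under reflected exponential tilting. -/
def tiltDrift (x : ℝ) : ℝ := if |x| < 1 then x * (1 - Real.exp x) else 0

lemma integrable_tiltDrift (hν : IsLevyMeasure ν) : Integrable tiltDrift ν := by
  refine (hν.integrable_min.const_mul (Real.exp 1)).mono' ?_ (ae_of_all _ fun x => ?_)
  · unfold tiltDrift
    exact (Measurable.ite (measurableSet_lt (by fun_prop) measurable_const) (by fun_prop)
      measurable_const).aestronglyMeasurable
  · unfold tiltDrift
    split_ifs with h
    · have hx : x ^ 2 ≤ 1 := by rw [← sq_abs]; nlinarith [abs_nonneg x]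
      rw [min_eq_right hx]
      have h3 : ‖Complex.exp x - 1‖ ≤ ‖(x : ℂ)‖ * Real.exp ‖(x : ℂ)‖ := by
        simpa using Complex.norm_exp_sub_sum_le_norm_mul_exp x 1
      have h4 : ‖Complex.exp x - 1‖ = |1 - Real.exp x| := by
        rw [abs_sub_comm, ← Real.norm_eq_abs, ← Complex.norm_real]
        push_cast
        rfl
      rw [h4, Complex.norm_real, Real.norm_eq_abs] at h3
      have h5 : Real.exp |x| ≤ Real.exp 1 := Real.exp_le_exp.2 h.le
      rw [norm_mul, Real.norm_eq_abs, Real.norm_eq_abs]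
      calc _ ≤ |x| * (|x| * Real.exp 1) := by
            gcongr
            exact h3.trans (by gcongr)
        _ = _ := by rw [← sq_abs]; ring
    · simp only [norm_zero]; positivity

/-- The identity behind Esscher's transform. The summand `-σ2` of the drift comes from expanding `(1
- iu)²`; `tiltDrift` arises since the compensator of the tilted measure carries a factor `e^x` that
the original one lacks. -/
lemma levyExponent_reversedLevyMeasure (hν : IsLevyMeasure ν)
    (hJ : Integrable (fun x : ℝ => min 1 (x ^ 2) * (1 + Real.exp x)) ν) (σ2 : ℝ≥0) (d u : ℝ) :
    levyExponent (reversedLevyMeasure ν) σ2 (-d - σ2 + ∫ x, tiltDrift x ∂ν) u =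
      laplaceExponent ν σ2 d (1 - Complex.I * u) - laplaceExponent ν σ2 d 1 := by
  have hz : (1 - Complex.I * u) ∈ verticalClosedStrip 0 1 := by
    constructor <;> simp
  have h1 : (1 : ℂ) ∈ verticalClosedStrip 0 1 := by
    constructor <;> simp
  have key : ∀ x : ℝ, Real.exp x • expRem (Complex.I * u) (-x) =
      (expRem (1 - Complex.I * u) x - expRem 1 x) - Complex.I * u * (tiltDrift x : ℂ) := by
    intro x
    have e : Complex.exp ((1 - Complex.I * u) * x) =
        Complex.exp x * Complex.exp (Complex.I * u * (-x : ℝ)) := by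
      rw [← Complex.exp_add]; push_cast; ring_nf
    unfold expRem tiltDrift
    rw [e, Complex.real_smul, abs_neg]
    split_ifs <;> push_cast <;> ring_nf
  rw [levyExponent_eq_laplaceExponent]
  unfold laplaceExponent
  rw [integral_reversedLevyMeasure]
  simp_rw [key]
  have hi : Integrable (fun x => expRem (1 - Complex.I * u) x - expRem 1 x) ν :=
    (integrable_expRem hJ hz).sub (integrable_expRem hJ h1)
  have hd : Integrable (fun x => Complex.I * u * (tiltDrift x : ℂ)) ν :=
    (integrable_tiltDrift hν).ofReal.const_mul _
  rw [integral_sub hi hd, integral_sub (integrable_expRem hJ hz)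
    (integrable_expRem hJ h1), integral_const_mul, integral_complex_ofReal]
  push_cast
  ring

lemma exists_laplaceExponent_one_eq_ofReal (σ2 : ℝ≥0) (d : ℝ) :
    ∃ r : ℝ, laplaceExponent ν σ2 d 1 = r := by
  refine ⟨d + σ2 / 2 + ∫ x, (Real.exp x - 1 - if |x| < 1 then x else 0) ∂ν, ?_⟩
  unfold laplaceExponent expRem
  push_cast
  rw [← integral_complex_ofReal]
  congr 1
  · simp
  · refine integral_congr_ae (ae_of_all _ fun x => ?_)
    simp only
    split_ifs <;> simp

end Tilt

/-! ### The dual marginals -/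

/-- The marginals of the Lévy process whose killing at rate `θp` gives the dual of the Lévy
process with marginals `p` killed at rate `θm`. -/
def dualMarginals (θp θm : ℝ≥0) (p : ℝ≥0 → Measure ℝ) (t : ℝ≥0) : Measure ℝ :=
  ENNReal.ofReal (Real.exp (θp * t)) • reversedLevyMeasure (killed θm p t)

lemma killed_dualMarginals (θp θm : ℝ≥0) (p : ℝ≥0 → Measure ℝ) :
    killed θp (dualMarginals θp θm p) = fun t => reversedLevyMeasure (killed θm p t) := by
  ext1 t
  rw [killed, dualMarginals, smul_smul, ← ENNReal.ofReal_mul (Real.exp_pos _).le, ← Real.exp_add]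
  simp

lemma dualMarginals_eq (θp θm : ℝ≥0) (p : ℝ≥0 → Measure ℝ) (t : ℝ≥0) :
    dualMarginals θp θm p t =
      ENNReal.ofReal (Real.exp (t * (θp - θm : ℝ))) • reversedLevyMeasure (p t) := by
  unfold dualMarginals killed
  rw [reversedLevyMeasure_smul, smul_smul, ← ENNReal.ofReal_mul (Real.exp_pos _).le,
    ← Real.exp_add]
  ring_nf

/-- The mass of the reflected tilt is an exponential moment. Being substochastic is thus where
moment bounds at all times come from. -/
lemma integral_exp_le_of_reversedLevyMeasure_univ_le {θ : ℝ≥0} {p : ℝ≥0 → Measure ℝ} {t : ℝ≥0}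
    (h : reversedLevyMeasure (killed θ p t) univ ≤ 1) :
    Integrable (fun x : ℝ => Real.exp x) (p t) ∧ ∫ x, Real.exp x ∂(p t) ≤ Real.exp (θ * t) := by
  rw [← lintegral_one, killed, reversedLevyMeasure_smul, lintegral_smul_measure,
    lintegral_reversedLevyMeasure (f := fun _ => 1) _ measurable_const] at h
  simp only [mul_one, smul_eq_mul] at h
  have h1 : ∫⁻ x, ENNReal.ofReal (Real.exp x) ∂(p t) ≤ ENNReal.ofReal (Real.exp (θ * t)) := by
    calc _ = ENNReal.ofReal (Real.exp (θ * t)) * (ENNReal.ofReal (Real.exp (-(θ * t))) *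
          ∫⁻ x, ENNReal.ofReal (Real.exp x) ∂(p t)) := by
          rw [← mul_assoc, ← ENNReal.ofReal_mul (Real.exp_pos _).le, ← Real.exp_add]
          simp
      _ ≤ ENNReal.ofReal (Real.exp (θ * t)) * 1 := by gcongr
      _ = _ := mul_one _
  have h2 : Integrable (fun x : ℝ => Real.exp x) (p t) := by
    refine ⟨by fun_prop, ?_⟩
    rw [hasFiniteIntegral_iff_ofReal (ae_of_all _ fun x => (Real.exp_pos x).le)]
    exact h1.trans_lt ENNReal.ofReal_lt_top
  refine ⟨h2, ?_⟩
  rw [← ofReal_integral_eq_lintegral_ofReal h2 (ae_of_all _ fun x => (Real.exp_pos x).le)] at h1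
  exact (ENNReal.ofReal_le_ofReal_iff (Real.exp_pos _).le).1 h1

/-- The drift of the reversed quintuple. -/
def dualDrift (ν : Measure ℝ) (σ2 : ℝ≥0) (d : ℝ) : ℝ := -d - σ2 + ∫ x, tiltDrift x ∂ν

/-- Evaluating the extended formula at `z = 1` gives the normalising constant, and at `z = 1 - iu`
the characteristic function. The exponential moment of the dual is immediate: `e^{-x}` cancels the
tilt `e^x`. -/
theorem Quintuple.HasMarginals.dualMarginals {ν : Measure ℝ} {σ2 : ℝ≥0} {d : ℝ} {θp θm : ℝ≥0}
    {p : ℝ≥0 → Measure ℝ} (h : Quintuple.HasMarginals ⟨ν, σ2, d, θp, θm⟩ p)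
    (hκ : ∀ t, reversedLevyMeasure (killed θm p t) univ ≤ 1) :
    Quintuple.HasMarginals ⟨reversedLevyMeasure ν, σ2, dualDrift ν σ2 d, θm, θp⟩
      (dualMarginals θp θm p) := by
  have hm : IsLevyMarginals ν σ2 d p := h.marginals
  have hi := fun t => (integral_exp_le_of_reversedLevyMeasure_univ_le (hκ t)).1
  have hJ := hm.integrable_min_mul_one_add_exp θm.coe_nonneg hi
    fun t => (integral_exp_le_of_reversedLevyMeasure_univ_le (hκ t)).2
  have hν := hm.levyMeasure
  have hone : (1 : ℂ) ∈ verticalClosedStrip 0 1 := by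
    constructor <;> simp
  obtain ⟨r, hr⟩ := exists_laplaceExponent_one_eq_ofReal (ν := ν) σ2 d
  have hexp : ∀ t : ℝ≥0, ∫ x, Real.exp x ∂(p t) = Real.exp (t * r) := by
    intro t
    have := hm.integral_exp_eq hJ t (hi t) hone
    rw [hr] at this
    have e : ∀ x : ℝ, Complex.exp (1 * x) = ((Real.exp x : ℝ) : ℂ) := fun x => by simp
    simp_rw [e] at this
    rw [integral_complex_ofReal] at this
    exact_mod_cast this
  have hrθ : r = θm - θp := by
    have := h.psi_one
    rw [hexp 1, Real.log_exp] at this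
    simpa using this
  have hprob : ∀ t, IsProbabilityMeasure (LBR.dualMarginals θp θm p t) := by
    intro t
    constructor
    rw [dualMarginals_eq, ← lintegral_one, lintegral_smul_measure,
      lintegral_reversedLevyMeasure (f := fun _ => 1) _ measurable_const]
    simp only [mul_one, smul_eq_mul]
    rw [← ofReal_integral_eq_lintegral_ofReal (hi t) (ae_of_all _ fun x => (Real.exp_pos x).le),
      hexp, ← ENNReal.ofReal_mul (Real.exp_pos _).le, ← Real.exp_add, hrθ]
    ring_nf
    simp
  refine ⟨⟨isLevyMeasure_reversedLevyMeasure hν hJ, hprob, ?_⟩, ?_, ?_⟩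
  · intro t u
    have hz : (1 - Complex.I * u) ∈ verticalClosedStrip 0 1 := by
      constructor <;> simp
    have h1 := hm.integral_exp_eq hJ t (hi t) hz
    simp only [dualDrift]
    rw [levyExponent_reversedLevyMeasure hν hJ, charFun_apply_real, dualMarginals_eq,
      integral_smul_measure, integral_reversedLevyMeasure, ENNReal.toReal_ofReal (Real.exp_pos _).le]
    have e : ∀ x : ℝ, Real.exp x • Complex.exp (u * (-x : ℝ) * Complex.I) =
        Complex.exp ((1 - Complex.I * u) * x) := by
      intro x
      rw [Complex.real_smul, Complex.ofReal_exp, ← Complex.exp_add]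
      push_cast
      ring_nf
    simp_rw [e]
    rw [h1, Complex.real_smul, Complex.ofReal_exp, ← Complex.exp_add, hr, hrθ]
    push_cast
    ring_nf
  · refine Integrable.congr (f := fun x => Real.exp x) ?_ (ae_of_all _ fun _ => rfl)
    rw [dualMarginals_eq]
    refine Integrable.smul_measure ?_ ENNReal.ofReal_ne_top
    rw [integrable_reversedLevyMeasure_iff]
    have := hm.prob 1
    refine (integrable_const (1 : ℝ)).congr (ae_of_all _ fun x => ?_)
    simp [← Real.exp_add]
  · have := hm.prob 1
    rw [dualMarginals_eq, integral_smul_measure, integral_reversedLevyMeasure,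
      ENNReal.toReal_ofReal (Real.exp_pos _).le]
    simp [← Real.exp_add]

/-! ### Uniqueness of the drift -/

theorem Quintuple.HasMarginals.drift_unique {ν : Measure ℝ} {σ2 : ℝ≥0} {d d' : ℝ} {θp θm : ℝ≥0}
    {p p' : ℝ≥0 → Measure ℝ} (h : Quintuple.HasMarginals ⟨ν, σ2, d, θp, θm⟩ p)
    (h' : Quintuple.HasMarginals ⟨ν, σ2, d', θp, θm⟩ p') : d' = d := by
  have := h.marginals.prob 1
  have := h'.marginals.prob 1
  -- The exponents differ by `i (d' - d) u`, so the laws at time 1 differ by a translation, which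
  -- shifts the logarithm of the exponential moment by `d' - d`.
  have hmap : p' 1 = (p 1).map (fun x => x + (d' - d)) := by
    have : IsProbabilityMeasure ((p 1).map (fun x => x + (d' - d))) :=
      Measure.isProbabilityMeasure_map (by fun_prop)
    refine Measure.ext_of_charFun ?_
    ext u
    rw [charFun_map_add_const, h.marginals.charFun_eq, h'.marginals.charFun_eq, ← Complex.exp_add]
    congr 1
    unfold levyExponent
    simp
    ring
  have h1 := h'.psi_one
  have h2 := h.psi_one
  simp only at h1 h2
  have hpos : 0 < ∫ x, Real.exp x ∂(p 1) := integral_exp_pos h.integrable_exp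
  rw [hmap, integral_map (by fun_prop) (by fun_prop)] at h1
  simp_rw [Real.exp_add] at h1
  rw [integral_mul_const, Real.log_mul hpos.ne' (Real.exp_pos _).ne', Real.log_exp] at h1
  linarith

/-! ### Identification of the dual kernel -/

lemma measurable_map_add_apply (κ : Measure ℝ) [SFinite κ] {B : Set ℝ} (hB : MeasurableSet B) :
    Measurable fun x : ℝ => κ.map (fun z => x + z) B := by
  have h : ∀ x : ℝ, κ.map (fun z => x + z) B = κ (Prod.mk x ⁻¹' ((fun q : ℝ × ℝ => q.1 + q.2) ⁻¹' B)) :=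
    fun x => Measure.map_apply (by fun_prop) hB
  simp_rw [h]
  exact measurable_measure_prodMk_left (measurable_add hB)

/-- Written as double integrals, the two sides are exchanged by `x = y + w` for each jump `w`: the
tilt `e^w` pays for moving the density from `e^{-x}` to `e^{-y}`. -/
lemma setLIntegral_map_reversedLevyMeasure (q : Measure ℝ) [SFinite q] {A B : Set ℝ}
    (hA : MeasurableSet A) (hB : MeasurableSet B) :
    ∫⁻ x in A, (reversedLevyMeasure q).map (fun z => x + z) B ∂expMeasure =
      ∫⁻ y in B, q.map (fun z => y + z) A ∂expMeasure := by
  have hE : Measurable fun u : ℝ => ENNReal.ofReal (Real.exp (-u)) := by fun_prop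
  have hsf : SFinite (reversedLevyMeasure q) := by unfold reversedLevyMeasure; infer_instance
  have hA1 : Measurable (A.indicator (1 : ℝ → ℝ≥0∞)) := measurable_one.indicator hA
  have hB1 : Measurable (B.indicator (1 : ℝ → ℝ≥0∞)) := measurable_one.indicator hB
  have hL : ∫⁻ x in A, (reversedLevyMeasure q).map (fun z => x + z) B ∂expMeasure =
      ∫⁻ x, ∫⁻ w, ENNReal.ofReal (Real.exp (w - x)) * A.indicator 1 x * B.indicator 1 (x - w) ∂q := by
    unfold expMeasure
    rw [← lintegral_indicator hA, lintegral_withDensity_eq_lintegral_mul _ hE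
      ((measurable_map_add_apply _ hB).indicator hA)]
    refine lintegral_congr fun x => ?_
    have e1 : (reversedLevyMeasure q).map (fun z => x + z) B =
        ∫⁻ w, ENNReal.ofReal (Real.exp w) * B.indicator 1 (x - w) ∂q := by
      rw [← lintegral_indicator_one hB, lintegral_map hB1 (by fun_prop),
        lintegral_reversedLevyMeasure _ (by fun_prop)]
      rfl
    have e2 : A.indicator (fun x => (reversedLevyMeasure q).map (fun z => x + z) B) x =
        A.indicator 1 x * (reversedLevyMeasure q).map (fun z => x + z) B := by
      by_cases hx : x ∈ A <;> simp [hx]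
    rw [Pi.mul_apply, e2, e1, ← lintegral_const_mul _ (by fun_prop),
      ← lintegral_const_mul _ (by fun_prop)]
    refine lintegral_congr fun w => ?_
    rw [sub_eq_add_neg w x, Real.exp_add, ENNReal.ofReal_mul (Real.exp_pos _).le]
    ring
  have hR : ∫⁻ y in B, q.map (fun z => y + z) A ∂expMeasure =
      ∫⁻ y, ∫⁻ w, ENNReal.ofReal (Real.exp (-y)) * A.indicator 1 (y + w) * B.indicator 1 y ∂q := by
    unfold expMeasure
    rw [← lintegral_indicator hB, lintegral_withDensity_eq_lintegral_mul _ hE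
      ((measurable_map_add_apply _ hA).indicator hB)]
    refine lintegral_congr fun y => ?_
    have e1 : q.map (fun z => y + z) A = ∫⁻ w, A.indicator 1 (y + w) ∂q := by
      rw [← lintegral_indicator_one hA, lintegral_map hA1 (by fun_prop)]
    have e2 : B.indicator (fun y => q.map (fun z => y + z) A) y =
        B.indicator 1 y * q.map (fun z => y + z) A := by
      by_cases hx : y ∈ B <;> simp [hx]
    rw [Pi.mul_apply, e2, e1, ← lintegral_const_mul _ (by fun_prop),
      ← lintegral_const_mul _ (by fun_prop)]
    refine lintegral_congr fun w => ?_
    ring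
  rw [hL, hR, lintegral_lintegral_swap (Measurable.aemeasurable (by fun_prop))]
  refine Eq.trans ?_ (lintegral_lintegral_swap (Measurable.aemeasurable (by fun_prop))).symm
  refine lintegral_congr fun w => ?_
  rw [← lintegral_add_right_eq_self (fun x => ENNReal.ofReal (Real.exp (w - x)) *
    A.indicator 1 x * B.indicator 1 (x - w)) w]
  refine lintegral_congr fun y => ?_
  simp

lemma expMeasure_Icc_ne_zero : expMeasure (Icc 0 1) ≠ 0 := by
  intro h
  unfold expMeasure at h
  rw [withDensity_apply_eq_zero (by fun_prop)] at h
  have e : {x : ℝ | ENNReal.ofReal (Real.exp (-x)) ≠ 0} = univ := by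
    ext x; simp [Real.exp_pos]
  rw [e, univ_inter] at h
  simp at h

lemma expMeasure_Icc_lt_top : expMeasure (Icc 0 1) < ∞ := by
  unfold expMeasure
  rw [withDensity_apply _ measurableSet_Icc]
  refine setLIntegral_lt_top_of_isCompact (by simp) isCompact_Icc
    (f := fun u => Real.toNNReal (Real.exp (-u))) (by fun_prop)

lemma map_shear_prod_apply (μ ρ : Measure ℝ) [SFinite ρ] {A B : Set ℝ} (hA : MeasurableSet A)
    (hB : MeasurableSet B) :
    (μ.prod ρ).map (fun z : ℝ × ℝ => (z.1, z.1 + z.2)) (A ×ˢ B) =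
      ∫⁻ x in A, ρ.map (fun z => x + z) B ∂μ := by
  have hshear : Measurable fun z : ℝ × ℝ => (z.1, z.1 + z.2) := by fun_prop
  rw [Measure.map_apply hshear (hA.prod hB), Measure.prod_apply (hshear (hA.prod hB)),
    ← lintegral_indicator hA]
  refine lintegral_congr fun x => ?_
  have := Measure.map_apply (μ := ρ) (measurable_const_add x) hB
  by_cases hx : x ∈ A
  · simp [hx, this, mk_preimage_prod, preimage_preimage]
  · simp [hx, mk_preimage_prod, preimage_preimage]

/-- A kernel dual to a finite spatially homogeneous kernel is its reflected exponential tilt. -/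
theorem IsDual.eq_reversedLevyMeasure {κ q : ℝ≥0 → Measure ℝ} [∀ t, IsFiniteMeasure (κ t)]
    [∀ t, IsFiniteMeasure (q t)] (h : IsDual (transition κ) (transition q)) (t : ℝ≥0) :
    κ t = reversedLevyMeasure (q t) := by
  have hsf : SFinite (reversedLevyMeasure (q t)) := by unfold reversedLevyMeasure; infer_instance
  -- A finite nonzero piece of the reference measure suffices: homogeneity makes the joint law a
  -- shear of a product, so undoing the shear and cancelling the mass of `μ` isolates `κ t`.
  set μ := expMeasure.restrict (Icc 0 1) with hμ
  have hfin : IsFiniteMeasure μ := ⟨by rw [hμ, Measure.restrict_apply_univ]; exact expMeasure_Icc_lt_top⟩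
  have hshear : Measurable fun z : ℝ × ℝ => (z.1, z.1 + z.2) := by fun_prop
  have hext : (μ.prod (κ t)).map (fun z : ℝ × ℝ => (z.1, z.1 + z.2)) =
      (μ.prod (reversedLevyMeasure (q t))).map (fun z : ℝ × ℝ => (z.1, z.1 + z.2)) := by
    refine Measure.ext_prod fun {A B} hA hB => ?_
    rw [map_shear_prod_apply _ _ hA hB, map_shear_prod_apply _ _ hA hB, hμ,
      Measure.restrict_restrict hA,
      setLIntegral_map_reversedLevyMeasure _ (hA.inter measurableSet_Icc) hB]
    exact h t _ B (hA.inter measurableSet_Icc) hB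
  have hprod : μ.prod (κ t) = μ.prod (reversedLevyMeasure (q t)) := by
    have := congrArg (Measure.map fun z : ℝ × ℝ => (z.1, z.2 - z.1)) hext
    rw [Measure.map_map (by fun_prop) hshear, Measure.map_map (by fun_prop) hshear] at this
    simpa [Function.comp_def] using this
  ext B hB
  have := congrArg (fun m => m (univ ×ˢ B)) hprod
  simp only [Measure.prod_prod] at this
  refine (ENNReal.mul_right_inj ?_ (measure_ne_top μ univ)).1 this
  rw [hμ, Measure.restrict_apply_univ]
  exact expMeasure_Icc_ne_zero

lemma IsDual.symm {q q' : ℝ≥0 → ℝ → Measure ℝ} (h : IsDual q q') : IsDual q' q :=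
  fun t A B hA hB => (h t B A hB hA).symm

/-! ### Stochastic continuity -/

section Tail

variable {ν : Measure ℝ} {σ2 : ℝ≥0} {d : ℝ} {p : ℝ≥0 → Measure ℝ}

/-- Tails are controlled by the characteristic function near the origin, where `|1 - e^{tψ(u)}| ≤ t
|ψ(u)|`. -/
lemma IsLevyMarginals.measureReal_abs_gt_le (h : IsLevyMarginals ν σ2 d p) {ε : ℝ} (hε : 0 < ε) :
    ∃ C : ℝ, ∀ t : ℝ≥0, (p t).real {x | ε < |x|} ≤ C * t := by
  set K := |d| + σ2 + 3 * ∫ x, min 1 (x ^ 2) ∂ν with hK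
  have hK0 : 0 ≤ K := by
    have : 0 ≤ ∫ x, min 1 (x ^ 2) ∂ν := integral_nonneg fun x => by positivity
    positivity
  refine ⟨2⁻¹ * ε * (K * (1 + (2 * ε⁻¹) ^ 2) * |2 * ε⁻¹ - -2 * ε⁻¹|), fun t => ?_⟩
  have := h.prob t
  refine (measureReal_abs_gt_le_integral_charFun hε).trans ?_
  have hb : ‖∫ u in (-2 * ε⁻¹)..(2 * ε⁻¹), 1 - charFun (p t) u‖ ≤
      (t * (K * (1 + (2 * ε⁻¹) ^ 2))) * |2 * ε⁻¹ - -2 * ε⁻¹| := by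
    refine intervalIntegral.norm_integral_le_of_norm_le_const fun u hu => ?_
    rw [uIoc_of_le (by have := inv_pos.2 hε; linarith)] at hu
    have hu2 : u ^ 2 ≤ (2 * ε⁻¹) ^ 2 := sq_le_sq' (by linarith [hu.1]) hu.2
    rw [norm_sub_rev, h.charFun_eq]
    refine (norm_exp_sub_one_le_of_re_nonpos ?_).trans ?_
    · rw [Complex.re_ofReal_mul]
      exact mul_nonpos_of_nonneg_of_nonpos t.coe_nonneg (h.re_levyExponent_nonpos u)
    · rw [norm_mul, Complex.norm_real, Real.norm_of_nonneg t.coe_nonneg]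
      have := h.levyMeasure.norm_levyExponent_le σ2 d u
      refine mul_le_mul_of_nonneg_left (this.trans ?_) t.coe_nonneg
      exact mul_le_mul_of_nonneg_left (by linarith) hK0
  calc _ ≤ 2⁻¹ * ε * ((t * (K * (1 + (2 * ε⁻¹) ^ 2))) * |2 * ε⁻¹ - -2 * ε⁻¹|) := by gcongr
    _ = _ := by ring

lemma IsLevyMarginals.tendsto_killed (h : IsLevyMarginals ν σ2 d p) (θ : ℝ≥0) {ε : ℝ}
    (hε : 0 < ε) :
    Tendsto (fun t : ℝ≥0 => killed θ p t {x | |x| ≤ ε}) (𝓝 0) (𝓝 1) := by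
  obtain ⟨C, hC⟩ := h.measureReal_abs_gt_le hε
  have h0 : Tendsto (fun t : ℝ≥0 => C * (t : ℝ)) (𝓝 0) (𝓝 0) := by
    have : Continuous fun t : ℝ≥0 => C * (t : ℝ) := by fun_prop
    simpa using this.tendsto 0
  have h1 : Tendsto (fun t : ℝ≥0 => (p t).real {x | ε < |x|}) (𝓝 0) (𝓝 0) :=
    squeeze_zero (fun t => measureReal_nonneg) hC h0
  have h2 : ∀ t : ℝ≥0, p t {x | |x| ≤ ε} = ENNReal.ofReal (1 - (p t).real {x | ε < |x|}) := by
    intro t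
    have := h.prob t
    have hm : MeasurableSet {x : ℝ | ε < |x|} := measurableSet_lt measurable_const (by fun_prop)
    rw [← probReal_compl_eq_one_sub hm, ofReal_measureReal]
    congr 1
    ext x
    simp
  have h3 : Tendsto (fun t : ℝ≥0 => ENNReal.ofReal (Real.exp (-((θ : ℝ) * t)))) (𝓝 0) (𝓝 1) := by
    have : Continuous fun t : ℝ≥0 => ENNReal.ofReal (Real.exp (-((θ : ℝ) * t))) :=
      ENNReal.continuous_ofReal.comp (by fun_prop)
    simpa using this.tendsto 0
  have h4 : Tendsto (fun t : ℝ≥0 => p t {x | |x| ≤ ε}) (𝓝 0) (𝓝 1) := by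
    simp_rw [h2]
    have := (ENNReal.continuous_ofReal.tendsto _).comp (h1.const_sub 1)
    simpa [Function.comp_def] using this
  have := ENNReal.Tendsto.mul h3 (Or.inl one_ne_zero) h4 (Or.inl one_ne_zero)
  simpa [killed] using this

lemma IsLevyMarginals.killed_univ (h : IsLevyMarginals ν σ2 d p) (θ t : ℝ≥0) :
    killed θ p t univ = ENNReal.ofReal (Real.exp (-((θ : ℝ) * t))) := by
  have := h.prob t
  simp [killed]

lemma IsLevyMarginals.isFiniteMeasure_killed (h : IsLevyMarginals ν σ2 d p) (θ t : ℝ≥0) :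
    IsFiniteMeasure (killed θ p t) :=
  ⟨by rw [h.killed_univ]; exact ENNReal.ofReal_lt_top⟩

end Tail

/-! ### Absence of fixed discontinuities -/

variable {Ω : Type*} [MeasurableSpace Ω] {P : Measure Ω}

/-- Both states are the cemetery, or both are alive at distance at most `ε`. -/
def Near (ε : ℝ) (a b : EReal) : Prop :=
  (a = ⊥ ∧ b = ⊥) ∨ ∃ x y : ℝ, a = x ∧ b = y ∧ |y - x| ≤ ε

lemma Near.symm {ε : ℝ} {a b : EReal} (h : Near ε a b) : Near ε b a := by
  rcases h with ⟨h1, h2⟩ | ⟨x, y, hx, hy, hxy⟩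
  · exact Or.inl ⟨h2, h1⟩
  · exact Or.inr ⟨y, x, hy, hx, by rwa [abs_sub_comm]⟩

lemma eq_of_frequently_near {u : ℕ → EReal} {a b : EReal} (hu : Tendsto u atTop (𝓝 a))
    (h : ∀ k : ℕ, ∃ᶠ n in atTop, Near (1 / (k + 1)) (u n) b) : a = b := by
  induction b using EReal.rec with
  | bot =>
    have : ∃ᶠ n in atTop, u n ∈ ({⊥} : Set EReal) := (h 0).mono fun n hn => by
      rcases hn with ⟨h1, _⟩ | ⟨x, y, _, h2, _⟩
      · exact h1
      · exact absurd h2.symm (EReal.coe_ne_bot y)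
    exact isClosed_singleton.mem_of_frequently_of_tendsto this hu
  | top =>
    obtain ⟨n, hn⟩ := (h 0).exists
    rcases hn with ⟨_, h1⟩ | ⟨x, y, _, h2, _⟩
    · exact absurd h1 top_ne_bot
    · exact absurd h2.symm (EReal.coe_ne_top y)
  | coe b =>
    have hk : ∀ k : ℕ, a ∈ Icc ((b - 1 / (k + 1) : ℝ) : EReal) ((b + 1 / (k + 1) : ℝ) : EReal) := by
      intro k
      refine isClosed_Icc.mem_of_frequently_of_tendsto ((h k).mono fun n hn => ?_) hu
      rcases hn with ⟨_, h1⟩ | ⟨x, y, h1, h2, h3⟩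
      · exact absurd h1 (EReal.coe_ne_bot b)
      · rw [h1]
        rw [EReal.coe_eq_coe_iff] at h2
        rw [← h2, abs_le] at h3
        exact ⟨EReal.coe_le_coe_iff.2 (by linarith), EReal.coe_le_coe_iff.2 (by linarith)⟩
    have hlim := tendsto_one_div_add_atTop_nhds_zero_nat (𝕜 := ℝ)
    have h1 : Tendsto (fun k : ℕ => ((b - 1 / (k + 1) : ℝ) : EReal)) atTop (𝓝 b) := by
      refine (continuous_coe_real_ereal.tendsto b).comp ?_
      simpa using hlim.const_sub b
    have h2 : Tendsto (fun k : ℕ => ((b + 1 / (k + 1) : ℝ) : EReal)) atTop (𝓝 b) := by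
      refine (continuous_coe_real_ereal.tendsto b).comp ?_
      simpa using hlim.const_add b
    exact le_antisymm (ge_of_tendsto' h2 fun k => (hk k).2) (le_of_tendsto' h1 fun k => (hk k).1)

/-- Closeness infinitely often is enough to identify a limit already known to exist, and convergence
in probability provides it without passing to a subsequence. -/
lemma ae_eq_of_tendsto_of_tendsto_near {X : ℕ → Ω → EReal} {Z Y : Ω → EReal}
    (hX : ∀ ω, Tendsto (fun n => X n ω) atTop (𝓝 (Z ω)))
    (h : ∀ ε : ℝ, 0 < ε → Tendsto (fun n => P {ω | ¬ Near ε (X n ω) (Y ω)}) atTop (𝓝 0)) :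
    Z =ᵐ[P] Y := by
  have key : ∀ k : ℕ, ∀ᵐ ω ∂P, ∃ᶠ n in atTop, Near (1 / (k + 1)) (X n ω) (Y ω) := by
    intro k
    have hs : {ω | ¬ ∃ᶠ n in atTop, Near (1 / ((k : ℝ) + 1)) (X n ω) (Y ω)} ⊆
        ⋃ N, ⋂ n ∈ Ici N, {ω | ¬ Near (1 / ((k : ℝ) + 1)) (X n ω) (Y ω)} := by
      intro ω hω
      obtain ⟨N, hN⟩ := eventually_atTop.1 (not_frequently.1 hω)
      exact mem_iUnion.2 ⟨N, mem_iInter₂.2 fun n hn => hN n hn⟩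
    refine measure_mono_null hs (measure_iUnion_null fun N => le_antisymm ?_ zero_le)
    refine ge_of_tendsto (h (1 / ((k : ℝ) + 1)) (by positivity)) ?_
    filter_upwards [eventually_ge_atTop N] with n hn
    exact measure_mono (biInter_subset_of_mem hn)
  filter_upwards [ae_all_iff.2 key] with ω hω
  exact eq_of_frequently_near (hX ω) hω

lemma IsKilledLevy.measure_alive {Y : ℝ≥0 → Ω → EReal} {κ : ℝ≥0 → Measure ℝ}
    (hY : IsKilledLevy Y κ P) (t : ℝ≥0) {B : Set ℝ} (hB : MeasurableSet B) :
    P {ω | ∃ x ∈ B, Y t ω = (x : EReal)} = κ t B := by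
  have := hY.fdd [(t, B)] (by simpa using hB)
  simpa [Visits, pathMass, transition] using this

lemma IsKilledLevy.measure_near {Y : ℝ≥0 → Ω → EReal} {κ : ℝ≥0 → Measure ℝ}
    [∀ t, IsFiniteMeasure (κ t)] [IsFiniteMeasure P]
    (hY : IsKilledLevy Y κ P) (s h : ℝ≥0) (ε : ℝ) :
    P {ω | ∃ x y : ℝ, Y s ω = x ∧ Y (s + h) ω = y ∧ |y - x| ≤ ε} =
      κ s univ * κ h {x | |x| ≤ ε} := by
  set G : Set Ω := {ω | (Y s ω ≠ ⊥ ∧ Y s ω ≠ ⊤) ∧ (Y (s + h) ω ≠ ⊥ ∧ Y (s + h) ω ≠ ⊤)} with hG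
  have hms := hY.measurable s
  have hmt := hY.measurable (s + h)
  have hm : Measurable fun ω => ((Y s ω).toReal, (Y (s + h) ω).toReal) :=
    (hms.ereal_toReal).prodMk hmt.ereal_toReal
  have hGm : MeasurableSet G := by
    refine MeasurableSet.inter (MeasurableSet.inter ?_ ?_) (MeasurableSet.inter ?_ ?_)
    · exact (hms (measurableSet_singleton ⊥)).compl
    · exact (hms (measurableSet_singleton ⊤)).compl
    · exact (hmt (measurableSet_singleton ⊥)).compl
    · exact (hmt (measurableSet_singleton ⊤)).compl
  have hset : ∀ (A : Set (ℝ × ℝ)), (fun ω => ((Y s ω).toReal, (Y (s + h) ω).toReal)) ⁻¹' A ∩ G =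
      {ω | ∃ x y : ℝ, Y s ω = x ∧ Y (s + h) ω = y ∧ (x, y) ∈ A} := by
    intro A
    ext ω
    constructor
    · rintro ⟨h1, ⟨h2, h3⟩, h4, h5⟩
      exact ⟨_, _, (EReal.coe_toReal h3 h2).symm, (EReal.coe_toReal h5 h4).symm, h1⟩
    · rintro ⟨x, y, hx, hy, hA⟩
      refine ⟨?_, ?_⟩
      · simpa [hx, hy] using hA
      · simp [hG, hx, hy]
  -- On the event of being alive at both times, the increment over `h` is independent of the
  -- position at time `s`: the joint law is a sheared product measure.
  have hlaw : (P.restrict G).map (fun ω => ((Y s ω).toReal, (Y (s + h) ω).toReal)) =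
      ((κ s).prod (κ h)).map (fun z : ℝ × ℝ => (z.1, z.1 + z.2)) := by
    refine Measure.ext_prod fun {A B} hA hB => ?_
    rw [map_shear_prod_apply _ _ hA hB, Measure.map_apply hm (hA.prod hB),
      Measure.restrict_apply (hm (hA.prod hB)), hset]
    have := hY.fdd [(s, A), (h, B)] (by simp [hA, hB])
    simp only [Visits, pathMass, transition, zero_add, and_true, Measure.map_id',
      setLIntegral_one] at this
    rw [← this]
    congr 1
    ext ω
    constructor
    · rintro ⟨x, y, hx, hy, h1, h2⟩
      exact ⟨⟨x, h1, hx⟩, y, h2, hy⟩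
    · rintro ⟨⟨x, h1, hx⟩, y, h2, hy⟩
      exact ⟨x, y, hx, hy, h1, h2⟩
  have hA : MeasurableSet {z : ℝ × ℝ | |z.2 - z.1| ≤ ε} :=
    measurableSet_le (by fun_prop) measurable_const
  have := congrArg (fun m => m {z : ℝ × ℝ | |z.2 - z.1| ≤ ε}) hlaw
  rw [Measure.map_apply hm hA, Measure.restrict_apply (hm hA), hset,
    Measure.map_apply (by fun_prop) hA] at this
  simp only [mem_ofPred_eq] at this
  rw [this, ← Measure.prod_prod]
  congr 1
  ext z
  simp

variable {ν : Measure ℝ} {σ2 : ℝ≥0} {d : ℝ} {p : ℝ≥0 → Measure ℝ} {θ : ℝ≥0}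

/-- If the states are not near, the particle is alive at one of the two times outside the good event
`C`. The survival probability decreases in time, so either possibility costs at most the survival
probability at `s` times `1 - k`. -/
lemma IsKilledLevy.measure_not_near_le [IsProbabilityMeasure P] {Y : ℝ≥0 → Ω → EReal}
    (hY : IsKilledLevy Y (killed θ p) P) (hp : IsLevyMarginals ν σ2 d p)
    (htop : ∀ t ω, Y t ω ≠ ⊤) (s h : ℝ≥0) (ε : ℝ) :
    P {ω | ¬ Near ε (Y s ω) (Y (s + h) ω)} ≤ 2 * (1 - killed θ p h {x | |x| ≤ ε}) := by
  have hfin := hp.isFiniteMeasure_killed θ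
  set C := {ω | ∃ x y : ℝ, Y s ω = x ∧ Y (s + h) ω = y ∧ |y - x| ≤ ε} with hC
  set A : ℝ≥0 → Set Ω := fun t => {ω | ∃ x ∈ (univ : Set ℝ), Y t ω = (x : EReal)} with hA
  have hA1 : ∀ t, P (A t) = killed θ p t univ := fun t => hY.measure_alive t MeasurableSet.univ
  have hAm : ∀ t, MeasurableSet (A t) := by
    intro t
    have : A t = Y t ⁻¹' {⊥, ⊤}ᶜ := by
      ext ω
      simp only [hA, mem_univ, true_and, mem_ofPred_eq, mem_preimage, mem_compl_iff, mem_insert_iff,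
        mem_singleton_iff, not_or]
      constructor
      · rintro ⟨x, hx⟩
        simp [hx]
      · rintro ⟨h1, h2⟩
        exact ⟨_, (EReal.coe_toReal h2 h1).symm⟩
    rw [this]
    exact hY.measurable t ((measurableSet_singleton _).insert _).compl
  have hCs : C ⊆ A s := fun ω ⟨x, _, hx, _⟩ => ⟨x, trivial, hx⟩
  have hCt : C ⊆ A (s + h) := fun ω ⟨_, y, _, hy, _⟩ => ⟨y, trivial, hy⟩
  have hCP : P C = killed θ p s univ * killed θ p h {x | |x| ≤ ε} := hY.measure_near s h ε
  have hCm : NullMeasurableSet C P := by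
    have h1 : C = {ω | Y s ω ∈ range ((↑) : ℝ → EReal) ∧ Y (s + h) ω ∈ range ((↑) : ℝ → EReal) ∧
        |(Y (s + h) ω).toReal - (Y s ω).toReal| ≤ ε} := by
      ext ω
      constructor
      · rintro ⟨x, y, hx, hy, hxy⟩
        exact ⟨⟨x, hx.symm⟩, ⟨y, hy.symm⟩, by simpa [hx, hy] using hxy⟩
      · rintro ⟨⟨x, hx⟩, ⟨y, hy⟩, hxy⟩
        exact ⟨x, y, hx.symm, hy.symm, by simpa [← hx, ← hy] using hxy⟩
    have h2 : C = A s ∩ (A (s + h) ∩ {ω | |(Y (s + h) ω).toReal - (Y s ω).toReal| ≤ ε}) := by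
      rw [h1]
      ext ω
      simp [hA, eq_comm]
    rw [h2]
    have := (hY.measurable s).ereal_toReal
    have := (hY.measurable (s + h)).ereal_toReal
    exact ((hAm _).inter ((hAm _).inter
      (measurableSet_le (by fun_prop) measurable_const))).nullMeasurableSet
  have hsub : {ω | ¬ Near ε (Y s ω) (Y (s + h) ω)} ⊆ (A s \ C) ∪ (A (s + h) \ C) := by
    intro ω hω
    have hωC : ω ∉ C := fun hc => hω (Or.inr hc)
    by_cases h1 : Y s ω = ⊥
    · by_cases h2 : Y (s + h) ω = ⊥
      · exact absurd (Or.inl ⟨h1, h2⟩) hω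
      · exact Or.inr ⟨⟨_, trivial, (EReal.coe_toReal (htop _ _) h2).symm⟩, hωC⟩
    · exact Or.inl ⟨⟨_, trivial, (EReal.coe_toReal (htop _ _) h1).symm⟩, hωC⟩
  set k := killed θ p h {x | |x| ≤ ε} with hk
  have hbound : ∀ t, s ≤ t → C ⊆ A t → P (A t \ C) ≤ 1 - k := by
    intro t hst hCt
    rw [measure_sdiff hCt hCm (measure_ne_top _ _), hA1, hCP]
    have h1 : killed θ p t univ ≤ killed θ p s univ := by
      rw [hp.killed_univ, hp.killed_univ]
      refine ENNReal.ofReal_le_ofReal (Real.exp_le_exp.2 ?_)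
      have : (s : ℝ) ≤ t := by exact_mod_cast hst
      have := mul_le_mul_of_nonneg_left this θ.coe_nonneg
      linarith
    have h2 : killed θ p s univ ≤ 1 := by rw [← hA1]; exact prob_le_one
    calc _ ≤ killed θ p s univ - killed θ p s univ * k := by gcongr
      _ = killed θ p s univ * (1 - k) := by
        rw [ENNReal.mul_sub (fun _ _ => measure_ne_top _ _), mul_one]
      _ ≤ 1 * (1 - k) := by gcongr
      _ = 1 - k := one_mul _
  calc _ ≤ P ((A s \ C) ∪ (A (s + h) \ C)) := measure_mono hsub
    _ ≤ P (A s \ C) + P (A (s + h) \ C) := measure_union_le _ _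
    _ ≤ (1 - k) + (1 - k) := add_le_add (hbound s le_rfl hCs) (hbound _ le_self_add hCt)
    _ = 2 * (1 - k) := (two_mul _).symm

lemma IsLevyMarginals.tendsto_one_sub_killed (hp : IsLevyMarginals ν σ2 d p) {ε : ℝ} (hε : 0 < ε)
    {h : ℕ → ℝ≥0} (hh : Tendsto h atTop (𝓝 0)) :
    Tendsto (fun n => 2 * (1 - killed θ p (h n) {x | |x| ≤ ε})) atTop (𝓝 0) := by
  have h1 := ENNReal.Tendsto.sub (tendsto_const_nhds (x := (1 : ℝ≥0∞)))
    ((hp.tendsto_killed θ hε).comp hh) (Or.inl ENNReal.one_ne_top)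
  have := ENNReal.Tendsto.const_mul (a := 2) h1 (Or.inr (by simp))
  simpa using this

lemma IsCaglad.tendsto_rightLim {f : ℝ≥0 → EReal} (hf : IsCaglad f) (t : ℝ≥0) :
    Tendsto f (𝓝[>] t) (𝓝 (Function.rightLim f t)) := by
  obtain ⟨-, -, l, -, hl⟩ := hf t
  exact tendsto_rightLim_of_tendsto ⟨l, hl⟩

lemma IsCadlag.tendsto_leftLim {f : ℝ≥0 → EReal} (hf : IsCadlag f) (t : ℝ≥0) :
    Tendsto f (𝓝[<] t) (𝓝 (Function.leftLim f t)) := by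
  obtain ⟨-, -, l, -, hl⟩ := hf t
  exact tendsto_leftLim_of_tendsto ⟨l, hl⟩

/-- A killed Lévy process has no fixed discontinuities: right limits. -/
lemma IsKilledLevy.rightLim_ae_eq [IsProbabilityMeasure P] {Y : ℝ≥0 → Ω → EReal}
    (hY : IsKilledLevy Y (killed θ p) P) (hp : IsLevyMarginals ν σ2 d p)
    (hc : ∀ ω, IsCaglad fun t => Y t ω) (t : ℝ≥0) :
    (fun ω => Function.rightLim (fun s => Y s ω) t) =ᵐ[P] Y t := by
  have hh : Tendsto (fun n : ℕ => (1 / ((n : ℝ≥0) + 1))) atTop (𝓝 0) :=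
    tendsto_one_div_add_atTop_nhds_zero_nat
  have ht : Tendsto (fun n : ℕ => t + 1 / ((n : ℝ≥0) + 1)) atTop (𝓝[>] t) := by
    refine tendsto_nhdsWithin_iff.2 ⟨by simpa using hh.const_add t, Eventually.of_forall fun n => ?_⟩
    exact lt_add_of_pos_right t (by positivity)
  refine ae_eq_of_tendsto_of_tendsto_near (X := fun n ω => Y (t + 1 / ((n : ℝ≥0) + 1)) ω)
    (fun ω => ((hc ω).tendsto_rightLim t).comp ht) fun ε hε => ?_
  refine tendsto_of_tendsto_of_tendsto_of_le_of_le tendsto_const_nhds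
    (hp.tendsto_one_sub_killed (θ := θ) hε hh) (fun _ => zero_le) fun n => ?_
  refine (measure_mono fun ω hω => ?_).trans
    (hY.measure_not_near_le hp (fun s ω => (hc ω s).1) t (1 / ((n : ℝ≥0) + 1)) ε)
  exact fun hn => hω hn.symm

/-- A killed Lévy process has no fixed discontinuities: left limits. -/
lemma IsKilledLevy.leftLim_ae_eq [IsProbabilityMeasure P] {Y : ℝ≥0 → Ω → EReal}
    (hY : IsKilledLevy Y (killed θ p) P) (hp : IsLevyMarginals ν σ2 d p)
    (hc : ∀ ω, IsCadlag fun t => Y t ω) (t : ℝ≥0) :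
    (fun ω => Function.leftLim (fun s => Y s ω) t) =ᵐ[P] Y t := by
  rcases eq_zero_or_pos t with rfl | ht0
  · exact Eventually.of_forall fun ω => leftLim_eq_of_isBot isBot_bot
  -- Scaling the step by `t` keeps `t - t / (n + 1)` nonnegative, so that truncated subtraction in
  -- `ℝ≥0` does no harm.
  have hh : Tendsto (fun n : ℕ => t * (1 / ((n : ℝ≥0) + 1))) atTop (𝓝 0) := by
    have := (tendsto_one_div_add_atTop_nhds_zero_nat (𝕜 := ℝ≥0)).const_mul t
    simpa using this
  have hle : ∀ n : ℕ, t * (1 / ((n : ℝ≥0) + 1)) ≤ t := fun n => by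
    refine mul_le_of_le_one_right zero_le ?_
    rw [div_le_one (by positivity)]
    exact le_add_self
  have ht : Tendsto (fun n : ℕ => t - t * (1 / ((n : ℝ≥0) + 1))) atTop (𝓝[<] t) := by
    refine tendsto_nhdsWithin_iff.2 ⟨by simpa using tendsto_const_nhds.sub hh,
      Eventually.of_forall fun n => ?_⟩
    exact tsub_lt_self ht0 (by positivity)
  refine ae_eq_of_tendsto_of_tendsto_near
    (X := fun n ω => Y (t - t * (1 / ((n : ℝ≥0) + 1))) ω)
    (fun ω => ((hc ω).tendsto_leftLim t).comp ht) fun ε hε => ?_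
  refine tendsto_of_tendsto_of_tendsto_of_le_of_le tendsto_const_nhds
    (hp.tendsto_one_sub_killed (θ := θ) hε hh) (fun _ => zero_le) fun n => ?_
  have := hY.measure_not_near_le hp (fun s ω => (hc ω s).1)
    (t - t * (1 / ((n : ℝ≥0) + 1))) (t * (1 / ((n : ℝ≥0) + 1))) ε
  rwa [tsub_add_cancel_of_le (hle n)] at this

/-! ### Regularity of the processes of one-sided limits -/

lemma tendsto_rightLim_nhdsLT {α β : Type*} [LinearOrder α] [TopologicalSpace α] [OrderTopology α]
    [TopologicalSpace β] [T3Space β] {f : α → β} {a : α} {l : β}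
    (h : Tendsto f (𝓝[<] a) (𝓝 l)) : Tendsto (Function.rightLim f) (𝓝[<] a) (𝓝 l) := by
  rcases eq_or_neBot (𝓝[<] a) with h' | h'
  · simp [h']
  obtain ⟨b, hb⟩ : (Iio a).Nonempty := Filter.nonempty_of_mem (self_mem_nhdsWithin (a := a))
  -- A right limit at a point just left of `a` is a limit of values that are themselves near `l`, so
  -- it stays in a closed neighbourhood; where no limit exists, `rightLim` is by default the value
  -- itself.
  refine (closed_nhds_basis l).tendsto_right_iff.2 ?_
  rintro s ⟨s_mem, s_closed⟩
  obtain ⟨u, au, hu⟩ : ∃ u, u < a ∧ Ioo u a ⊆ {x | f x ∈ s} := by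
    have := (closed_nhds_basis l).tendsto_right_iff.1 h s ⟨s_mem, s_closed⟩
    simpa using (mem_nhdsLT_iff_exists_Ioo_subset' hb).1 this
  filter_upwards [Ioo_mem_nhdsLT au] with c hc
  rcases eq_or_neBot (𝓝[>] c) with h'c | h'c
  · simpa [h'c, rightLim_eq_of_eq_bot] using hu hc
  by_cases! h''c : ¬ ∃ y, Tendsto f (𝓝[>] c) (𝓝 y)
  · simpa [rightLim_eq_of_not_tendsto _ h''c] using hu hc
  apply s_closed.mem_of_tendsto (tendsto_rightLim_of_tendsto h''c)
  filter_upwards [Ioo_mem_nhdsGT_of_mem ⟨hc.1.le, hc.2⟩] with e he using hu he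

lemma tendsto_leftLim_nhdsGT {α β : Type*} [LinearOrder α] [TopologicalSpace α] [OrderTopology α]
    [TopologicalSpace β] [T3Space β] {f : α → β} {a : α} {l : β}
    (h : Tendsto f (𝓝[>] a) (𝓝 l)) : Tendsto (Function.leftLim f) (𝓝[>] a) (𝓝 l) :=
  tendsto_rightLim_nhdsLT (α := αᵒᵈ) h

lemma IsCaglad.isCadlag_rightLim {f : ℝ≥0 → EReal} (hf : IsCaglad f) :
    IsCadlag (Function.rightLim f) := by
  intro t
  have hr := hf.tendsto_rightLim t
  refine ⟨?_, continuousWithinAt_rightLim_Ici hr, f t, (hf t).1, ?_⟩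
  · obtain ⟨-, -, l, hl, hlt⟩ := hf t
    rwa [tendsto_nhds_unique hr hlt]
  · exact tendsto_rightLim_nhdsLT ((hf t).2.1.mono_left (nhdsWithin_mono _ Iio_subset_Iic_self))

lemma IsCadlag.isCaglad_leftLim {f : ℝ≥0 → EReal} (hf : IsCadlag f) :
    IsCaglad (Function.leftLim f) := by
  intro t
  have hl := hf.tendsto_leftLim t
  refine ⟨?_, continuousWithinAt_leftLim_Iic hl, f t, (hf t).1, ?_⟩
  · rcases eq_or_neBot (𝓝[<] t) with h | h
    · rw [leftLim_eq_of_eq_bot _ h]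
      exact (hf t).1
    · obtain ⟨-, -, l, hl', hlt⟩ := hf t
      rwa [tendsto_nhds_unique hl hlt]
  · exact tendsto_leftLim_nhdsGT ((hf t).2.1.mono_left (nhdsWithin_mono _ Ioi_subset_Ici_self))

/-! ### Evaluation of regular paths along grids -/

/-- The values of a path on the grids `ℕ / (n + 1)`. -/
def gridValues (f : ℝ≥0 → EReal) (q : ℕ × ℕ) : EReal := f (q.2 / (q.1 + 1))

/-- The limit, along the grids `ℕ / (n + 1)`, of the values at the grid points selected by `k`. -/
def gridLim (k : ℕ → ℝ≥0 → ℕ) (q : ℝ≥0 × (ℕ × ℕ → EReal)) : EReal :=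
  limsup (fun n => q.2 (n, k n q.1)) atTop

lemma measurable_gridValues : Measurable gridValues :=
  measurable_pi_lambda _ fun _ => measurable_pi_apply _

/-- The grids are countable, so evaluation at a measurably varying grid point is jointly measurable,
unlike evaluation on the full path space. This gives meaning to regular paths at random times. -/
lemma measurable_gridLim {k : ℕ → ℝ≥0 → ℕ} (hk : ∀ n, Measurable (k n)) :
    Measurable (gridLim k) := by
  refine Measurable.limsup fun n => ?_
  have h : Measurable fun z : ℕ × (ℕ × ℕ → EReal) => z.2 (n, z.1) :=
    measurable_from_prod_countable_right fun m =>
      measurable_pi_apply (X := fun _ : ℕ × ℕ => EReal) (n, m)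
  exact h.comp (((hk n).comp measurable_fst).prodMk measurable_snd)

lemma gridLim_eq {k : ℕ → ℝ≥0 → ℕ} {f : ℝ≥0 → EReal} {s : ℝ≥0} {S : Set ℝ≥0} {l : EReal}
    (hf : Tendsto f (𝓝[S] s) (𝓝 l)) (hS : ∀ n, (k n s / (n + 1) : ℝ≥0) ∈ S)
    (hd : ∀ n, dist (k n s / (n + 1) : ℝ≥0) s ≤ 1 / ((n : ℝ) + 1)) :
    gridLim k (s, gridValues f) = l := by
  refine Tendsto.limsup_eq (hf.comp (tendsto_nhdsWithin_iff.2 ⟨?_, Eventually.of_forall hS⟩))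
  exact tendsto_iff_dist_tendsto_zero.2 (squeeze_zero (fun _ => dist_nonneg) hd
    tendsto_one_div_add_atTop_nhds_zero_nat)

/-- The last grid point that is at most `s`. -/
def gridFloor (n : ℕ) (s : ℝ≥0) : ℕ := ⌊s * (n + 1)⌋₊

/-- The first grid point that is at least `s`. -/
def gridCeil (n : ℕ) (s : ℝ≥0) : ℕ := ⌈s * (n + 1)⌉₊

/-- The first grid point that is larger than `s`. -/
def gridSucc (n : ℕ) (s : ℝ≥0) : ℕ := ⌊s * (n + 1)⌋₊ + 1

/-- The last grid point that is smaller than `s`. -/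
def gridPred (n : ℕ) (s : ℝ≥0) : ℕ := ⌈s * (n + 1)⌉₊ - 1

lemma measurable_gridFloor (n : ℕ) : Measurable (gridFloor n) :=
  Nat.measurable_floor.comp (by fun_prop)

lemma measurable_gridCeil (n : ℕ) : Measurable (gridCeil n) :=
  Nat.measurable_ceil.comp (by fun_prop)

lemma measurable_gridSucc (n : ℕ) : Measurable (gridSucc n) :=
  (measurable_of_countable fun m : ℕ => m + 1).comp (measurable_gridFloor n)

lemma measurable_gridPred (n : ℕ) : Measurable (gridPred n) :=
  (measurable_of_countable fun m : ℕ => m - 1).comp (measurable_gridCeil n)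

lemma dist_div_le {n m : ℕ} {s : ℝ≥0} (h1 : (m : ℝ) ≤ s * (n + 1) + 1)
    (h2 : (s : ℝ) * (n + 1) ≤ m + 1) : dist (m / (n + 1) : ℝ≥0) s ≤ 1 / ((n : ℝ) + 1) := by
  have hn : (0 : ℝ) < n + 1 := by positivity
  rw [NNReal.dist_eq]
  push_cast
  have e : (m : ℝ) / (n + 1) - s = (m - s * (n + 1)) / (n + 1) := by field_simp
  rw [e, abs_div, abs_of_pos hn]
  gcongr
  rw [abs_le]
  constructor <;> linarith

lemma gridLim_gridFloor {f : ℝ≥0 → EReal} {s : ℝ≥0} (hf : ContinuousWithinAt f (Iic s) s) :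
    gridLim gridFloor (s, gridValues f) = f s := by
  have h1 : ∀ n : ℕ, (gridFloor n s : ℝ≥0) ≤ s * (n + 1) := fun n => Nat.floor_le zero_le
  have h2 : ∀ n : ℕ, s * (n + 1) < (gridFloor n s : ℝ≥0) + 1 := fun n => Nat.lt_floor_add_one _
  refine gridLim_eq hf (fun n => ?_) fun n => dist_div_le ?_ ?_
  · exact (div_le_iff₀ (by positivity)).2 (h1 n)
  · have : (gridFloor n s : ℝ) ≤ s * (n + 1) := by exact_mod_cast h1 n
    linarith
  · exact_mod_cast (h2 n).le

lemma gridLim_gridSucc {f : ℝ≥0 → EReal} {s : ℝ≥0} {l : EReal}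
    (hf : Tendsto f (𝓝[>] s) (𝓝 l)) :
    gridLim gridSucc (s, gridValues f) = l := by
  have h1 : ∀ n : ℕ, (gridFloor n s : ℝ≥0) ≤ s * (n + 1) := fun n => Nat.floor_le zero_le
  have h2 : ∀ n : ℕ, s * (n + 1) < (gridSucc n s : ℝ≥0) := fun n => by
    have := Nat.lt_floor_add_one (s * ((n : ℝ≥0) + 1))
    unfold gridSucc
    exact_mod_cast this
  refine gridLim_eq hf (fun n => ?_) fun n => dist_div_le ?_ ?_
  · exact (lt_div_iff₀ (by positivity)).2 (h2 n)
  · have : (gridFloor n s : ℝ) ≤ s * (n + 1) := by exact_mod_cast h1 n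
    have e : (gridSucc n s : ℝ) = gridFloor n s + 1 := by simp [gridSucc, gridFloor]
    rw [e]
    linarith
  · have : (s : ℝ) * (n + 1) < gridSucc n s := by exact_mod_cast h2 n
    linarith

lemma gridLim_gridCeil {f : ℝ≥0 → EReal} {s : ℝ≥0} (hf : ContinuousWithinAt f (Ici s) s) :
    gridLim gridCeil (s, gridValues f) = f s := by
  have h1 : ∀ n : ℕ, s * (n + 1) ≤ (gridCeil n s : ℝ≥0) := fun n => Nat.le_ceil _
  have h2 : ∀ n : ℕ, (gridCeil n s : ℝ≥0) < s * (n + 1) + 1 := fun n =>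
    Nat.ceil_lt_add_one zero_le
  refine gridLim_eq hf (fun n => ?_) fun n => dist_div_le ?_ ?_
  · exact (le_div_iff₀ (by positivity)).2 (h1 n)
  · exact_mod_cast (h2 n).le
  · have : (s : ℝ) * (n + 1) ≤ gridCeil n s := by exact_mod_cast h1 n
    linarith

lemma gridLim_gridPred {f : ℝ≥0 → EReal} {s : ℝ≥0}
    (hf : Tendsto f (𝓝[<] s) (𝓝 (Function.leftLim f s))) :
    gridLim gridPred (s, gridValues f) = Function.leftLim f s := by
  rcases eq_zero_or_pos s with rfl | hs
  · have e : Function.leftLim f (0 : ℝ≥0) = f 0 :=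
      leftLim_eq_of_isBot (a := (0 : ℝ≥0)) isBot_bot
    rw [e]
    -- At `0` the truncated subtraction `0 - 1 = 0` selects the value `f 0`, in agreement with the
    -- default of `leftLim` at the bottom element.
    simp [gridLim, gridPred, gridValues]
  have h1 : ∀ n : ℕ, s * (n + 1) ≤ (gridCeil n s : ℝ≥0) := fun n => Nat.le_ceil _
  have h2 : ∀ n : ℕ, (gridCeil n s : ℝ≥0) < s * (n + 1) + 1 := fun n =>
    Nat.ceil_lt_add_one zero_le
  have h3 : ∀ n : ℕ, (gridPred n s : ℝ) + 1 = gridCeil n s := fun n => by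
    have : 1 ≤ gridCeil n s := Nat.one_le_ceil_iff.2 (by positivity)
    have e : gridPred n s + 1 = gridCeil n s := Nat.sub_add_cancel this
    exact_mod_cast e
  have h2' : ∀ n : ℕ, (gridCeil n s : ℝ) < s * (n + 1) + 1 := fun n => by exact_mod_cast h2 n
  have h1' : ∀ n : ℕ, (s : ℝ) * (n + 1) ≤ gridCeil n s := fun n => by exact_mod_cast h1 n
  refine gridLim_eq hf (fun n => ?_) fun n => dist_div_le ?_ ?_
  · have : (gridPred n s : ℝ) < s * (n + 1) := by linarith [h3 n, h2' n]
    exact (div_lt_iff₀ (by positivity : (0 : ℝ≥0) < n + 1)).2 (by exact_mod_cast this)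
  · linarith [h3 n, h2' n]
  · linarith [h3 n, h1' n]

section Evaluation

variable {Ω : Type*}

/-- The process of right limits. -/
def rightProcess (Y : ℝ≥0 → Ω → EReal) (t : ℝ≥0) (ω : Ω) : EReal :=
  Function.rightLim (fun s => Y s ω) t

/-- The process of left limits. -/
def leftProcess (Y : ℝ≥0 → Ω → EReal) (t : ℝ≥0) (ω : Ω) : EReal :=
  Function.leftLim (fun s => Y s ω) t

lemma pathSigma_le_of_gridLim {Y Y' : ℝ≥0 → Ω → EReal} {k : ℕ → ℝ≥0 → ℕ}
    (hk : ∀ n, Measurable (k n))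
    (hY' : ∀ s ω, gridLim k (s, gridValues fun t => Y t ω) = Y' s ω) :
    ParticleSystem.pathSigma Y' ≤ ParticleSystem.pathSigma Y := by
  unfold ParticleSystem.pathSigma
  have hΦ : Measurable fun (f : ℝ≥0 → EReal) (t : ℝ≥0) => gridLim k (t, gridValues f) :=
    measurable_pi_lambda _ fun t =>
      (measurable_gridLim hk).comp (measurable_const.prodMk measurable_gridValues)
  have e : (fun ω t => Y' t ω) =
      (fun (f : ℝ≥0 → EReal) (t : ℝ≥0) => gridLim k (t, gridValues f)) ∘ fun ω t => Y t ω := by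
    ext ω t
    exact (hY' t ω).symm
  rw [e, ← MeasurableSpace.comap_comp]
  exact MeasurableSpace.comap_mono hΦ.comap_le

lemma gridLim_rightProcess {Y : ℝ≥0 → Ω → EReal} (hc : ∀ ω, IsCaglad fun t => Y t ω)
    (s : ℝ≥0) (ω : Ω) : gridLim gridSucc (s, gridValues fun t => Y t ω) = rightProcess Y s ω :=
  gridLim_gridSucc ((hc ω).tendsto_rightLim s)

lemma gridLim_leftProcess {Y : ℝ≥0 → Ω → EReal} (hc : ∀ ω, IsCadlag fun t => Y t ω)
    (s : ℝ≥0) (ω : Ω) : gridLim gridPred (s, gridValues fun t => Y t ω) = leftProcess Y s ω :=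
  gridLim_gridPred ((hc ω).tendsto_leftLim s)

variable [MeasurableSpace Ω] {P : Measure Ω}

lemma measurable_eval_of_gridLim {Y : ℝ≥0 → Ω → EReal} {k : ℕ → ℝ≥0 → ℕ}
    (hk : ∀ n, Measurable (k n)) (hYm : ∀ t, Measurable (Y t))
    (hY : ∀ s ω, gridLim k (s, gridValues fun t => Y t ω) = Y s ω) {τ : Ω → ℝ≥0}
    (hτ : Measurable τ) : Measurable fun ω => Y (τ ω) ω := by
  have h := (measurable_gridLim hk).comp
    (hτ.prodMk (measurable_gridValues.comp (measurable_pi_lambda _ hYm)))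
  exact (funext fun ω => hY (τ ω) ω : _ = _) ▸ h

/-- Two modifications of a process agree at an independent random time. -/
lemma ae_eq_eval_of_indepFun [IsProbabilityMeasure P] {Y Y' : ℝ≥0 → Ω → EReal}
    {k k' : ℕ → ℝ≥0 → ℕ}
    (hk : ∀ n, Measurable (k n)) (hk' : ∀ n, Measurable (k' n)) (hYm : ∀ t, Measurable (Y t))
    (hY : ∀ s ω, gridLim k (s, gridValues fun t => Y t ω) = Y s ω)
    (hY' : ∀ s ω, gridLim k' (s, gridValues fun t => Y t ω) = Y' s ω)
    (h : ∀ s, Y' s =ᵐ[P] Y s) {τ : Ω → ℝ≥0} (hτ : Measurable τ)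
    (hind : IndepFun τ (fun ω t => Y t ω) P) :
    ∀ᵐ ω ∂P, Y' (τ ω) ω = Y (τ ω) ω := by
  have hgm : Measurable fun ω => gridValues fun t => Y t ω :=
    measurable_gridValues.comp (measurable_pi_lambda _ hYm)
  have hind' : IndepFun τ (fun ω => gridValues fun t => Y t ω) P :=
    hind.comp measurable_id measurable_gridValues
  -- Under the product law, Fubini reduces the claim to each fixed time, where the modifications
  -- agree almost surely by hypothesis.
  have hlaw := (indepFun_iff_map_prod_eq_prod_map_map hτ.aemeasurable hgm.aemeasurable).1 hind'
  have hN : MeasurableSet {q : ℝ≥0 × (ℕ × ℕ → EReal) | gridLim k' q = gridLim k q} :=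
    measurableSet_eq_fun (measurable_gridLim hk') (measurable_gridLim hk)
  have h1 : ∀ᵐ q ∂(P.map fun ω => (τ ω, gridValues fun t => Y t ω)),
      gridLim k' q = gridLim k q := by
    rw [hlaw]
    have : IsProbabilityMeasure (P.map τ) := Measure.isProbabilityMeasure_map hτ.aemeasurable
    have : IsProbabilityMeasure (P.map fun ω => gridValues fun t => Y t ω) :=
      Measure.isProbabilityMeasure_map hgm.aemeasurable
    refine (Measure.ae_prod_iff_ae_ae hN).2 (ae_of_all _ fun s => ?_)
    refine (ae_map_iff hgm.aemeasurable (measurable_prodMk_left hN)).2 ?_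
    filter_upwards [h s] with ω hω
    show gridLim k' (s, _) = gridLim k (s, _)
    rw [hY, hY', hω]
  filter_upwards [ae_of_ae_map (hτ.prodMk hgm).aemeasurable h1] with ω hω
  rwa [hY, hY'] at hω

lemma ae_visits_iff {Y Y' : ℝ≥0 → Ω → EReal} (h : ∀ s, Y' s =ᵐ[P] Y s)
    (l : List (ℝ≥0 × Set ℝ)) (t : ℝ≥0) :
    ∀ᵐ ω ∂P, Visits (fun s => Y' s ω) t l ↔ Visits (fun s => Y s ω) t l := by
  induction l generalizing t with
  | nil => exact ae_of_all _ fun ω => Iff.rfl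
  | cons a l ih =>
    filter_upwards [h (t + a.1), ih (t + a.1)] with ω h1 h2
    simp only [Visits, h1, h2]

lemma IsKilledLevy.congr {Y Y' : ℝ≥0 → Ω → EReal} {κ : ℝ≥0 → Measure ℝ}
    (hY : IsKilledLevy Y κ P) (hm : ∀ t, Measurable (Y' t)) (h : ∀ s, Y' s =ᵐ[P] Y s) :
    IsKilledLevy Y' κ P := by
  refine ⟨hm, fun l hl => ?_⟩
  rw [← hY.fdd l hl]
  exact measure_congr (eventuallyEq_set.2 (ae_visits_iff h l 0))

lemma IsCadlag.gridLim_gridCeil {f : ℝ≥0 → EReal} (hf : IsCadlag f) (s : ℝ≥0) :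
    gridLim gridCeil (s, gridValues f) = f s := LBR.gridLim_gridCeil (hf s).2.1

lemma IsCaglad.gridLim_gridFloor {f : ℝ≥0 → EReal} (hf : IsCaglad f) (s : ℝ≥0) :
    gridLim gridFloor (s, gridValues f) = f s := LBR.gridLim_gridFloor (hf s).2.1

lemma measurable_of_gridLim {Y Y' : ℝ≥0 → Ω → EReal} {k : ℕ → ℝ≥0 → ℕ}
    (hk : ∀ n, Measurable (k n)) (hYm : ∀ t, Measurable (Y t))
    (hY' : ∀ s ω, gridLim k (s, gridValues fun t => Y t ω) = Y' s ω) (t : ℝ≥0) :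
    Measurable (Y' t) := by
  have h := (measurable_gridLim hk).comp (measurable_const (a := t) |>.prodMk
    (measurable_gridValues.comp (measurable_pi_lambda _ hYm)))
  exact (funext fun ω => hY' t ω : _ = _) ▸ h

end Evaluation

/-! ### Random points -/

namespace RandomPoints

variable {Ω : Type*} [MeasurableSpace Ω] {P : Measure Ω} {E F : Type*} [MeasurableSpace E]
  [MeasurableSpace F]

/-- The image of a random sequence of points. -/
def map (X : RandomPoints Ω E) (f : E → F) (hf : Measurable f) : RandomPoints Ω F where
  card := X.card
  pt i ω := f (X.pt i ω)
  measurable_card := X.measurable_card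
  measurable_pt i := hf.comp (X.measurable_pt i)

lemma count_map_apply (X : RandomPoints Ω E) {f : E → F} (hf : Measurable f) {B : Set F}
    (hB : MeasurableSet B) (ω : Ω) : (X.map f hf).count ω B = X.count ω (f ⁻¹' B) := by
  unfold count
  rw [Measure.sum_apply _ hB, Measure.sum_apply _ (hf hB)]
  refine tsum_congr fun i => ?_
  rw [Measure.dirac_apply' _ hB, Measure.dirac_apply' _ (hf hB)]
  rfl

lemma IsPPP.map {X : RandomPoints Ω E} {μ : Measure E} (h : X.IsPPP μ P) {f : E → F}
    (hf : Measurable f) : (X.map f hf).IsPPP (μ.map f) P := by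
  refine ⟨fun B hB hfin => ?_, fun n B hB hd => ?_⟩
  · simp_rw [X.count_map_apply hf hB]
    rw [Measure.map_apply hf hB] at hfin ⊢
    exact h.law _ (hf hB) hfin
  · simp_rw [fun j ω => X.count_map_apply hf (hB j) ω]
    exact h.indep n _ (fun j => hf (hB j)) fun j k hjk => (hd hjk).preimage f

lemma sigma_map_le (X : RandomPoints Ω E) {f : E → F} (hf : Measurable f) :
    (X.map f hf).sigma ≤ X.sigma := by
  unfold sigma
  have hΦ : Measurable fun q : ℕ∞ × (ℕ → E) => (q.1, fun i => f (q.2 i)) := by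
    fun_prop
  have e : (fun ω => ((X.map f hf).card ω, fun i => (X.map f hf).pt i ω)) =
      (fun q : ℕ∞ × (ℕ → E) => (q.1, fun i => f (q.2 i))) ∘
        fun ω => (X.card ω, fun i => X.pt i ω) := rfl
  rw [e, ← MeasurableSpace.comap_comp]
  exact MeasurableSpace.comap_mono hΦ.comap_le

/-- The number of points in a null set is Poisson with mean 0. -/
lemma IsPPP.ae_pt_notMem {X : RandomPoints Ω E} {μ : Measure E} (h : X.IsPPP μ P) {B : Set E}
    (hB : MeasurableSet B) (h0 : μ B = 0) :
    ∀ᵐ ω ∂P, ∀ i : ℕ, (i : ℕ∞) < X.card ω → X.pt i ω ∉ B := by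
  have hlaw := h.law B hB (by simp [h0])
  rw [h0] at hlaw
  have hprob : IsProbabilityMeasure
      ((poissonMeasure (0 : ℝ≥0∞).toNNReal).map (fun n : ℕ => (n : ℝ≥0∞))) :=
    Measure.isProbabilityMeasure_map (by fun_prop)
  -- A map that is not a.e. measurable pushes `P` forward to the zero measure, which contradicts the
  -- prescribed Poisson law.
  have hae : AEMeasurable (fun ω => X.count ω B) P := by
    by_contra hn
    rw [Measure.map_of_not_aemeasurable hn] at hlaw
    rw [← hlaw] at hprob
    exact IsProbabilityMeasure.ne_zero (0 : Measure ℝ≥0∞) rfl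
  have hzero : ∀ᵐ ω ∂P, X.count ω B = 0 := by
    refine ae_of_ae_map (p := fun z => z = 0) hae ?_
    rw [hlaw, ae_map_iff (f := fun n : ℕ => (n : ℝ≥0∞)) (p := fun z => z = 0) (by fun_prop)
      (measurableSet_singleton (0 : ℝ≥0∞))]
    rw [ae_iff]
    have hs : {n : ℕ | ¬ ((n : ℝ≥0∞) = 0)} = {0}ᶜ := by ext n; simp
    rw [hs, prob_compl_eq_zero_iff (measurableSet_singleton _), poissonMeasure_singleton]
    simp
  filter_upwards [hzero] with ω hω i hi hmem
  unfold count at hω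
  rw [Measure.sum_apply _ hB, ENNReal.tsum_eq_zero] at hω
  have := hω ⟨i, hi⟩
  rw [Measure.dirac_apply' _ hB] at this
  simp [hmem] at this

end RandomPoints

/-! ### Reversal of the particle system -/

/-- Time reversal of a time-position pair. -/
def reflectTime (q : ℝ × ℝ) : ℝ × ℝ := (-q.1, q.2)

lemma measurable_reflectTime : Measurable reflectTime := by
  unfold reflectTime; fun_prop

lemma map_neg_restrict_Iio : (volume.restrict (Iio (0 : ℝ))).map (fun x => -x) =
    volume.restrict (Ioi 0) := by
  have := (Measure.measurePreserving_neg (volume : Measure ℝ)).restrict_preimage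
    (s := Ioi 0) measurableSet_Ioi
  have e : (Neg.neg ⁻¹' Ioi (0 : ℝ)) = Iio 0 := by ext; simp
  rw [e] at this
  exact this.map_eq

lemma map_neg_restrict_Ioi : (volume.restrict (Ioi (0 : ℝ))).map (fun x => -x) =
    volume.restrict (Iio 0) := by
  have := (Measure.measurePreserving_neg (volume : Measure ℝ)).restrict_preimage
    (s := Iio 0) measurableSet_Iio
  have e : (Neg.neg ⁻¹' Iio (0 : ℝ)) = Ioi 0 := by ext; simp
  rw [e] at this
  exact this.map_eq

instance sigmaFinite_expMeasure : SigmaFinite expMeasure := by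
  unfold expMeasure; infer_instance

lemma map_reflectTime_prod (c : ℝ≥0) (μ : Measure ℝ) [SFinite μ] :
    ((c • μ).prod expMeasure).map reflectTime =
      (c • μ.map (fun x => -x)).prod expMeasure := by
  have h := Measure.map_prod_map (c • μ) expMeasure measurable_neg measurable_id
  rw [Measure.map_id] at h
  refine h.symm.trans ?_
  congr 1
  exact Measure.map_smul c μ _

namespace Source

/-- The relabelling of the ingredients under time reversal. -/
def reverse : Source → Source
  | init => init
  | born => dead
  | dead => born
  | Lp i => Lm i
  | Lm i => Lp i
  | bornL i => deadL i
  | deadL i => bornL i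

lemma reverse_injective : Function.Injective reverse := by
  have h : Function.Involutive reverse := fun s => by cases s <;> rfl
  exact h.injective

end Source

namespace ParticleSystem

variable {Ω : Type*} [MeasurableSpace Ω]

/-- The time-reversed particle system, with motions made regular. -/
def reverse (S : ParticleSystem Ω) : ParticleSystem Ω where
  init := S.init
  born := S.dead.map reflectTime measurable_reflectTime
  dead := S.born.map reflectTime measurable_reflectTime
  Lp i := rightProcess (S.Lm i)
  Lm i := leftProcess (S.Lp i)
  bornL i := rightProcess (S.deadL i)
  deadL i := leftProcess (S.bornL i)

variable {S : ParticleSystem Ω} {Q : Quintuple} {P : Measure Ω} {p κm : ℝ≥0 → Measure ℝ}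

/-- Each new ingredient is a measurable function of a single old one, and the relabelling is
injective; independence is therefore inherited. -/
lemma HasParameters.reverse_sigma_le (h : S.HasParameters Q P p κm) (s : Source) :
    S.reverse.sigma s ≤ S.sigma s.reverse := by
  cases s with
  | init => exact le_rfl
  | born => exact S.dead.sigma_map_le measurable_reflectTime
  | dead => exact S.born.sigma_map_le measurable_reflectTime
  | Lp i => exact pathSigma_le_of_gridLim measurable_gridSucc (gridLim_rightProcess (h.Lm_caglad i))
  | Lm i => exact pathSigma_le_of_gridLim measurable_gridPred (gridLim_leftProcess (h.Lp_cadlag i))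
  | bornL i =>
    exact pathSigma_le_of_gridLim measurable_gridSucc (gridLim_rightProcess (h.deadL_caglad i))
  | deadL i =>
    exact pathSigma_le_of_gridLim measurable_gridPred (gridLim_leftProcess (h.bornL_cadlag i))

lemma iSup_prop_eq_ite (q : Prop) [Decidable q] (a : EReal) : (⨆ (_ : q), a) = if q then a else ⊥ :=
  iSup_eq_if _

lemma measurable_iSup_lt_card {E : Type*} [MeasurableSpace E] (X : RandomPoints Ω E)
    {f : ℕ → Ω → EReal} (hf : ∀ i, Measurable (f i)) :
    Measurable fun ω => ⨆ (i : ℕ) (_ : (i : ℕ∞) < X.card ω), f i ω := by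
  classical
  refine Measurable.iSup fun i => ?_
  simp_rw [iSup_prop_eq_ite]
  exact Measurable.ite (X.measurable_card (MeasurableSet.of_discrete (s := Ioi (i : ℕ∞)))) (hf i) measurable_const

lemma HasParameters.measurable_bornL_eval (h : S.HasParameters Q P p κm) (i : ℕ) {τ : Ω → ℝ≥0}
    (hτ : Measurable τ) : Measurable fun ω => S.bornL i (τ ω) ω :=
  measurable_eval_of_gridLim measurable_gridCeil (h.bornL_law i).measurable
    (fun s ω => (h.bornL_cadlag i ω).gridLim_gridCeil s) hτ

lemma HasParameters.measurable_deadL_eval (h : S.HasParameters Q P p κm) (i : ℕ) {τ : Ω → ℝ≥0}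
    (hτ : Measurable τ) : Measurable fun ω => S.deadL i (τ ω) ω :=
  measurable_eval_of_gridLim measurable_gridFloor (h.deadL_law i).measurable
    (fun s ω => (h.deadL_caglad i ω).gridLim_gridFloor s) hτ

lemma HasParameters.measurable_eta (h : S.HasParameters Q P p κm) (t : ℝ) :
    Measurable (S.eta t) := by
  refine Measurable.sup (Measurable.sup ?_ ?_) ?_
  · refine measurable_iSup_lt_card _ fun i => ?_
    refine Measurable.add (S.init.measurable_pt i).coe_real_ereal ?_
    unfold twoSided
    split_ifs
    · exact (h.Lp_law i).measurable _
    · exact (h.Lm_law i).measurable _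
  · refine measurable_iSup_lt_card _ fun i => ?_
    have hT := S.born.measurable_pt i
    refine Measurable.ite (measurableSet_lt measurable_const hT.fst) measurable_const ?_
    exact hT.snd.coe_real_ereal.add
      (h.measurable_bornL_eval i (measurable_const.sub hT.fst).real_toNNReal)
  · refine measurable_iSup_lt_card _ fun i => ?_
    have hT := S.dead.measurable_pt i
    refine Measurable.ite (measurableSet_lt measurable_const hT.fst) ?_ measurable_const
    exact hT.snd.coe_real_ereal.add
      (h.measurable_deadL_eval i (hT.fst.sub measurable_const).real_toNNReal)

lemma HasParameters.measurable_eta_path (h : S.HasParameters Q P p κm) :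
    Measurable fun ω t => S.eta t ω := measurable_pi_lambda _ h.measurable_eta

lemma HasParameters.indepFun_born (h : S.HasParameters Q P p κm) (i : ℕ) {f : ℝ × ℝ → ℝ≥0}
    (hf : Measurable f) :
    IndepFun (fun ω => f (S.born.pt i ω)) (fun ω t => S.bornL i t ω) P := by
  have h1 : Indep S.born.sigma (pathSigma (S.bornL i)) P :=
    h.indep.indep (i := Source.born) (j := Source.bornL i) (by simp)
  have h2 : IndepFun (fun ω => (S.born.card ω, fun i => S.born.pt i ω))
      (fun ω t => S.bornL i t ω) P := h1
  exact h2.comp (φ := fun q : ℕ∞ × (ℕ → ℝ × ℝ) => f (q.2 i)) (ψ := id) (by fun_prop) measurable_id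

lemma HasParameters.indepFun_dead (h : S.HasParameters Q P p κm) (i : ℕ) {f : ℝ × ℝ → ℝ≥0}
    (hf : Measurable f) :
    IndepFun (fun ω => f (S.dead.pt i ω)) (fun ω t => S.deadL i t ω) P := by
  have h1 : Indep S.dead.sigma (pathSigma (S.deadL i)) P :=
    h.indep.indep (i := Source.dead) (j := Source.deadL i) (by simp)
  have h2 : IndepFun (fun ω => (S.dead.card ω, fun i => S.dead.pt i ω))
      (fun ω t => S.deadL i t ω) P := h1
  exact h2.comp (φ := fun q : ℕ∞ × (ℕ → ℝ × ℝ) => f (q.2 i)) (ψ := id) (by fun_prop) measurable_id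

/-- Almost surely no birth or death falls exactly at a given time. This is the one instant at which
the conventions `t < T` and `t ≥ T` are not compatible with reversal. -/
lemma prod_expMeasure_fiber_eq_zero (c : ℝ≥0) (A : Set ℝ) (t : ℝ) :
    ((c • volume.restrict A).prod expMeasure) ({t} ×ˢ univ) = 0 := by
  rw [Measure.prod_prod]
  have : (volume.restrict A) {t} = 0 := by simp
  simp [this]

variable {ν : Measure ℝ} {σ2 : ℝ≥0} {d : ℝ} {θp θm : ℝ≥0}

/-- The dual motions are the reflected exponential tilts of the forward motions. -/
lemma HasParameters.kernel_eq [IsProbabilityMeasure P] (h : S.HasParameters Q P p κm) :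
    κm = fun t => reversedLevyMeasure (killed Q.θm p t) := by
  have h1 : ∀ t, IsFiniteMeasure (κm t) := fun t =>
    ⟨by rw [← (h.Lm_law 0).measure_alive t MeasurableSet.univ]; exact measure_lt_top _ _⟩
  have h2 := h.marginals.marginals.isFiniteMeasure_killed Q.θm
  exact funext fun t => h.dual.eq_reversedLevyMeasure t

lemma HasParameters.kernel_univ_le [IsProbabilityMeasure P] (h : S.HasParameters Q P p κm)
    (t : ℝ≥0) : κm t univ ≤ 1 := by
  rw [← (h.Lm_law 0).measure_alive t MeasurableSet.univ]
  exact prob_le_one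

lemma HasParameters.hasMarginals_dual [IsProbabilityMeasure P]
    (h : S.HasParameters ⟨ν, σ2, d, θp, θm⟩ P p κm) :
    Quintuple.HasMarginals ⟨reversedLevyMeasure ν, σ2, dualDrift ν σ2 d, θm, θp⟩
      (dualMarginals θp θm p) :=
  h.marginals.dualMarginals fun t => by
    have := h.kernel_univ_le t
    rwa [h.kernel_eq] at this

lemma HasParameters.kernel_eq_killed [IsProbabilityMeasure P]
    (h : S.HasParameters ⟨ν, σ2, d, θp, θm⟩ P p κm) :
    κm = killed θp (LBR.dualMarginals θp θm p) := by
  rw [killed_dualMarginals]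
  exact h.kernel_eq

/-- The reversed particle system has the dual parameters. -/
theorem HasParameters.reverse [IsProbabilityMeasure P]
    (h : S.HasParameters ⟨ν, σ2, d, θp, θm⟩ P p κm) :
    S.reverse.HasParameters ⟨reversedLevyMeasure ν, σ2, dualDrift ν σ2 d, θm, θp⟩ P
      (dualMarginals θp θm p) (killed θm p) := by
  have hp := h.marginals.marginals
  have hp' := h.hasMarginals_dual.marginals
  have hκ := h.kernel_eq_killed
  have right : ∀ {Y : ℝ≥0 → Ω → EReal}, IsKilledLevy Y κm P → (∀ ω, IsCaglad fun t => Y t ω) →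
      IsKilledLevy (rightProcess Y) κm P := fun {Y} hY hc => by
    refine hY.congr (measurable_of_gridLim measurable_gridSucc hY.measurable
      (gridLim_rightProcess hc)) fun s => ?_
    rw [hκ] at hY
    exact hY.rightLim_ae_eq hp' hc s
  have left : ∀ {Y : ℝ≥0 → Ω → EReal}, IsKilledLevy Y (killed θm p) P →
      (∀ ω, IsCadlag fun t => Y t ω) → IsKilledLevy (leftProcess Y) (killed θm p) P :=
    fun {Y} hY hc => by
    refine hY.congr (measurable_of_gridLim measurable_gridPred hY.measurable
      (gridLim_leftProcess hc)) fun s => ?_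
    exact hY.leftLim_ae_eq hp hc s
  refine
    { marginals := h.hasMarginals_dual
      dual := ?_
      init_ppp := h.init_ppp
      born_ppp := ?_
      dead_ppp := ?_
      Lp_law := fun i => ?_
      Lm_law := fun i => left (h.Lp_law i) (h.Lp_cadlag i)
      bornL_law := fun i => ?_
      deadL_law := fun i => left (h.bornL_law i) (h.bornL_cadlag i)
      Lp_cadlag := fun i ω => (h.Lm_caglad i ω).isCadlag_rightLim
      Lm_caglad := fun i ω => (h.Lp_cadlag i ω).isCaglad_leftLim
      bornL_cadlag := fun i ω => (h.deadL_caglad i ω).isCadlag_rightLim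
      deadL_caglad := fun i ω => (h.bornL_cadlag i ω).isCaglad_leftLim
      indep := ?_ }
  · show IsDual (transition (killed θm p)) (transition (killed θp (LBR.dualMarginals θp θm p)))
    rw [← hκ]
    exact h.dual.symm
  · have := h.dead_ppp.map measurable_reflectTime
    rwa [map_reflectTime_prod, map_neg_restrict_Iio] at this
  · have := h.born_ppp.map measurable_reflectTime
    rwa [map_reflectTime_prod, map_neg_restrict_Ioi] at this
  · show IsKilledLevy _ (killed θp (LBR.dualMarginals θp θm p)) P
    rw [← hκ]
    exact right (h.Lm_law i) (h.Lm_caglad i)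
  · show IsKilledLevy _ (killed θp (LBR.dualMarginals θp θm p)) P
    rw [← hκ]
    exact right (h.deadL_law i) (h.deadL_caglad i)
  · exact iIndep_of_iIndep_of_le (h.indep.precomp Source.reverse_injective) h.reverse_sigma_le

/-! ### Comparison of the suprema of the two systems -/

lemma killed_zero_singleton {ν : Measure ℝ} {σ2 : ℝ≥0} {d : ℝ} {p : ℝ≥0 → Measure ℝ}
    (h : IsLevyMarginals ν σ2 d p) (θ : ℝ≥0) : killed θ p 0 {0} = 1 := by
  have := h.prob 0
  have e : p 0 = Measure.dirac 0 := by
    refine Measure.ext_of_charFun ?_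
    ext u
    rw [h.charFun_eq, charFun_dirac]
    simp
  simp [killed, e]

lemma _root_.LBR.IsKilledLevy.zero_ae_eq [IsProbabilityMeasure P] {Y : ℝ≥0 → Ω → EReal}
    {θ : ℝ≥0} (hY : IsKilledLevy Y (killed θ p) P) (hp : IsLevyMarginals ν σ2 d p) :
    ∀ᵐ ω ∂P, Y 0 ω = 0 := by
  have h := hY.measure_alive 0 (measurableSet_singleton 0)
  rw [killed_zero_singleton hp] at h
  have e : {ω | ∃ x ∈ ({0} : Set ℝ), Y 0 ω = (x : EReal)} = {ω | Y 0 ω = 0} := by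
    ext ω; simp
  rw [e] at h
  exact (prob_compl_eq_zero_iff (hY.measurable 0 (measurableSet_singleton 0))).2 h

/-- At each time, the supremum of the reversed system is that of the original system at the
reflected time. -/
theorem HasParameters.reverse_eta_ae_eq [IsProbabilityMeasure P]
    (h : S.HasParameters ⟨ν, σ2, d, θp, θm⟩ P p κm) (t : ℝ) :
    S.eta (-t) =ᵐ[P] S.reverse.eta t := by
  have hp := h.marginals.marginals
  have hp' := h.hasMarginals_dual.marginals
  have hκ := h.kernel_eq_killed
  have hLm := h.Lm_law
  have hdL := h.deadL_law
  rw [hκ] at hLm hdL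
  have hr := h.reverse
  have hV : ∀ i, ∀ᵐ ω ∂P, S.V i (-t) ω = S.reverse.V i t ω := by
    intro i
    unfold V twoSided
    rcases lt_trichotomy t 0 with ht | rfl | ht
    · filter_upwards [(h.Lp_law i).leftLim_ae_eq hp (h.Lp_cadlag i) (-t).toNNReal] with ω hω
      rw [if_pos (by linarith), if_neg (by linarith), ← hω]
      rfl
    -- At time `0` both systems use their own forward motion, and these are unrelated processes;
    -- they agree only because both start at `0` almost surely.
    · filter_upwards [(h.Lp_law i).zero_ae_eq hp, (hr.Lp_law i).zero_ae_eq hp'] with ω h1 h2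
      rw [if_pos (by simp), if_pos le_rfl]
      simp only [neg_zero, Real.toNNReal_zero]
      rw [h1, h2]
      rfl
    · filter_upwards [(hLm i).rightLim_ae_eq hp' (h.Lm_caglad i) t.toNNReal] with ω hω
      rw [if_neg (by linarith), if_pos ht.le, neg_neg, ← hω]
      rfl
  have hB : ∀ i : ℕ, ∀ᵐ ω ∂P, (i : ℕ∞) < S.born.card ω → S.bornV i (-t) ω = S.reverse.deadV i t ω := by
    intro i
    have hτ : Measurable fun q : ℝ × ℝ => (-t - q.1).toNNReal := by fun_prop
    filter_upwards [ae_eq_eval_of_indepFun measurable_gridCeil measurable_gridPred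
      (h.bornL_law i).measurable (fun s ω => (h.bornL_cadlag i ω).gridLim_gridCeil s)
      (gridLim_leftProcess (h.bornL_cadlag i))
      (fun s => (h.bornL_law i).leftLim_ae_eq hp (h.bornL_cadlag i) s)
      (hτ.comp (S.born.measurable_pt i)) (h.indepFun_born i hτ),
      h.born_ppp.ae_pt_notMem ((measurableSet_singleton (-t)).prod MeasurableSet.univ)
        (prod_expMeasure_fiber_eq_zero _ _ _)] with ω h1 h2 hi
    have hne : (S.born.pt i ω).1 ≠ -t := fun he => h2 i hi ⟨he, trivial⟩
    show (if -t < (S.born.pt i ω).1 then ⊥ else ((S.born.pt i ω).2 : EReal) +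
        S.bornL i (-t - (S.born.pt i ω).1).toNNReal ω) =
      if t < -(S.born.pt i ω).1 then ((S.born.pt i ω).2 : EReal) +
        leftProcess (S.bornL i) (-(S.born.pt i ω).1 - t).toNNReal ω else ⊥
    rcases lt_or_gt_of_ne hne with hlt | hgt
    · rw [if_neg (by linarith), if_pos (by linarith)]
      have e : -(S.born.pt i ω).1 - t = -t - (S.born.pt i ω).1 := by ring
      rw [e]
      exact congrArg _ h1.symm
    · rw [if_pos hgt, if_neg (by linarith)]
  have hD : ∀ i : ℕ, ∀ᵐ ω ∂P, (i : ℕ∞) < S.dead.card ω → S.deadV i (-t) ω = S.reverse.bornV i t ω := by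
    intro i
    have hτ : Measurable fun q : ℝ × ℝ => (q.1 - -t).toNNReal := by fun_prop
    filter_upwards [ae_eq_eval_of_indepFun measurable_gridFloor measurable_gridSucc
      (h.deadL_law i).measurable (fun s ω => (h.deadL_caglad i ω).gridLim_gridFloor s)
      (gridLim_rightProcess (h.deadL_caglad i))
      (fun s => (hdL i).rightLim_ae_eq hp' (h.deadL_caglad i) s)
      (hτ.comp (S.dead.measurable_pt i)) (h.indepFun_dead i hτ),
      h.dead_ppp.ae_pt_notMem ((measurableSet_singleton (-t)).prod MeasurableSet.univ)
        (prod_expMeasure_fiber_eq_zero _ _ _)] with ω h1 h2 hi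
    have hne : (S.dead.pt i ω).1 ≠ -t := fun he => h2 i hi ⟨he, trivial⟩
    show (if -t < (S.dead.pt i ω).1 then ((S.dead.pt i ω).2 : EReal) +
        S.deadL i ((S.dead.pt i ω).1 - -t).toNNReal ω else ⊥) =
      if t < -(S.dead.pt i ω).1 then ⊥ else ((S.dead.pt i ω).2 : EReal) +
        rightProcess (S.deadL i) (t - -(S.dead.pt i ω).1).toNNReal ω
    rcases lt_or_gt_of_ne hne with hlt | hgt
    · rw [if_neg (by linarith), if_pos (by linarith)]
    · rw [if_pos hgt, if_neg (by linarith)]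
      have e : t - -(S.dead.pt i ω).1 = (S.dead.pt i ω).1 - -t := by ring
      rw [e]
      exact congrArg _ h1.symm
  filter_upwards [ae_all_iff.2 hV, ae_all_iff.2 hB, ae_all_iff.2 hD] with ω h1 h2 h3
  unfold eta
  have e1 : (⨆ (i : ℕ) (_ : (i : ℕ∞) < S.init.card ω), S.V i (-t) ω) =
      ⨆ (i : ℕ) (_ : (i : ℕ∞) < S.reverse.init.card ω), S.reverse.V i t ω :=
    iSup_congr fun i => iSup_congr fun _ => h1 i
  have e2 : (⨆ (i : ℕ) (_ : (i : ℕ∞) < S.born.card ω), S.bornV i (-t) ω) =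
      ⨆ (i : ℕ) (_ : (i : ℕ∞) < S.reverse.dead.card ω), S.reverse.deadV i t ω :=
    iSup_congr fun i => iSup_congr fun hi => h2 i hi
  have e3 : (⨆ (i : ℕ) (_ : (i : ℕ∞) < S.dead.card ω), S.deadV i (-t) ω) =
      ⨆ (i : ℕ) (_ : (i : ℕ∞) < S.reverse.born.card ω), S.reverse.bornV i t ω :=
    iSup_congr fun i => iSup_congr fun hi => h3 i hi
  rw [e1, e2, e3, sup_assoc, sup_assoc, sup_comm (⨆ (i : ℕ) (_ : (i : ℕ∞) < S.reverse.dead.card ω), _)]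

end ParticleSystem

end LBR

end

theorem mainTheorem11 {Ω : Type*} [MeasurableSpace Ω] (P : Measure Ω) [IsProbabilityMeasure P]
    (η : ℝ → Ω → EReal) (νp : Measure ℝ) (σ2 : ℝ≥0) (dp : ℝ) (θp θm : ℝ≥0)
    (hη : LBR.IsLevyBrownResnick η P ⟨νp, σ2, dp, θp, θm⟩) :
    ∃ dm : ℝ,
      LBR.IsLevyBrownResnick (fun t ω => η (-t) ω) P
        ⟨LBR.reversedLevyMeasure νp, σ2, dm, θm, θp⟩ ∧
      ∀ d' : ℝ, (LBR.Quintuple.mk (LBR.reversedLevyMeasure νp) σ2 d' θm θp).IsAdmissible →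
        d' = dm := by
  obtain ⟨Ω', mΩ', P', hP', S, p, κm, hS, hid⟩ := hη
  refine ⟨LBR.dualDrift νp σ2 dp, ⟨Ω', mΩ', P', hP', S.reverse, _, _, hS.reverse, ?_⟩, ?_⟩
  · have hrefl : Measurable fun (f : ℝ → EReal) (t : ℝ) => f (-t) :=
      measurable_pi_lambda _ fun t => measurable_pi_apply _
    have h1 := hid.comp hrefl
    refine h1.trans ⟨(hrefl.comp hS.measurable_eta_path).aemeasurable,
      hS.reverse.measurable_eta_path.aemeasurable, ?_⟩
    -- A law on the product σ-algebra is determined by finitely many times at once, so almost sure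
    -- equality at each single time is enough.
    exact map_eq_of_forall_ae_eq (X := fun t ω => S.eta (-t) ω) (Y := fun t ω => S.reverse.eta t ω)
      (hrefl.comp hS.measurable_eta_path).aemeasurable
      hS.reverse.measurable_eta_path.aemeasurable hS.reverse_eta_ae_eq
  · rintro d' ⟨p', hp'⟩
    exact hS.hasMarginals_dual.drift_unique hp'
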